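/- **Conventions.** Fix $S>0$. An $S$-scaled vector space is a directed system of Banach spaces $(E_s)_{0<s<S}$ whose maps $E_t\to E_s$ ($s<t$) are injective of norm at most one; we write $E=\bigcup_s E_s$, and $|x|_s$ for the norm of $x\in E_s$. For $k\ge 0$ put $E^{(k)}=\{x\in E:\exists C,\tau>0,\ |x|_s\le Cs^k\ \forall s\le\tau\}$. A linear map $u:E\to F$ is a morphism if for every $t$ there is an $s$ such that $u$ maps $E_t$ continuously to $F_s$; morphisms $u_i$ converge to $u$ in $\mathcal L(E,F)$ if for every $t$ there is an $s$ with $\|u_i-u\|_{E_t\to F_s}\to 0$. For linear $u$ and $\tau<S$ put $$N^k_\tau(u)=\sup\Big\{(t-s)^k\frac{|u(x)|_s}{e\,|x|_t}:\ 0<s<t\le\tau,\ x\in E_t\setminus\{0\}\Big\}$$ (with $s=t$ also allowed if $k=0$); $u$ is $k$-bounded if $N^k_\tau(u)<\infty$ for some $\tau$. The $1$-bounded endomorphisms of $E$ are scaled by the norms $s\mapsto N^1_s$. An Arnold space $E_\bullet$ is a directed system $(E_n)_{n\in\mathbb N\cup\{\infty\}}$ of $S$-scaled vector spaces whose restriction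 maps $E_i\to E_j$ ($i\leq j$) satisfy $N^0_\tau\le 1$ for all $\tau<S$. We write $r$ for the restriction to $E_\infty$, and usually omit restrictions to finite indices; $|x|_{n,s}$ is the norm of $(E_n)_s$. A positive increasing sequence $(p_n)$ is tamed if $\sum_n 2^{-n}\log\max(1,p_n)<\infty$. A family of linear maps $u_\bullet=(u_n)_{n\in\mathbb N\cup\{\infty\}}$ is $k$-tamed if for some common $\tau$ all $N^k_\tau(u_n)$ are finite and $(N^k_\tau(u_n))_{n\in\mathbb N}$ is dominated by a tamed sequence. A closed subspace $M_\bullet$ of $W_\bullet\subset E_\bullet$ is a family of vector subspaces $M_n\subset W_n$, stable under the restrictions, such that $M_n\cap (E_n)_s$ is closed in $W_n\cap(E_n)_s$ for all $n,s$. By $E_\bullet^{(\mu)}$ we mean the family $E_n^{(\mu)}$, $n\in\mathbb N$ (no condition at $n=\infty$). An $m$-bounded splitting of $M_\bullet$ consists of two closed subspaces $F_\bullet,G_\bullet$ of $M_\bullet$ with $M_n=F_n\oplus G_n$ for all $n$, whose projections $\pi_n$ satisfy $N^m_\tau(\pi_n)\le 1$ for some $\tau$ independent of $n$. For $d\ge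 0$ let $\mathcal H^n_d(E_t)$ be the set of the $x\in E_t$ with $|x|_s\le (t-s)^{-d}(s/t)^{2^n}|x|_t$ for all $s<t$. **Theorem (abstract KAM theorem).** Let $E_\bullet$ be an Arnold space, $M_\bullet$ a closed subspace of $E_\bullet^{(\mu)}$, $\mu\ge 0$, and $F_\bullet,G_\bullet$ an $m$-bounded splitting of $M_\bullet$, $m\ge0$. Let $\mathfrak g_\bullet$ be a vector space of $1$-tamed families $u_\bullet=(u_n)$ of endomorphisms of the $E_n$ such that for each $u_\bullet\in\mathfrak g_\bullet$ and $n\in\mathbb N$ there is a $C$ with $N^1_s(u_n)\le Cs^2$ for all small $s$; let $\mathfrak g_n$ be the space of the $n$-th components, scaled by the norms $N^1_s$. Let $a\in E_0$, and assume that $\mathfrak g_\bullet$ leaves $G_\bullet$ invariant and maps $a$ into $G_\bullet$, and that for all $n$ and $\alpha\in F_n$ the map $\rho_n(\alpha):u\mapsto u(a+\alpha)$ takes $\mathfrak g_n$ into $G_n$. Let $k,l\ge 0$, let $(r_n)$ be a real sequence, and let $j_n(\alpha):G_n\to\mathfrak g_n$ ($\alpha\in F_n$) be linear maps such that A) for each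 $\alpha=(\alpha_n)\in\prod_n F_n$ with $\sup_n|\alpha_n|_{n,t}<\infty$ for some $t$, the family $j(\alpha)=(j_n(\alpha_n))$ is $k$-tamed, and it is a right quasi-inverse of $\rho(\alpha)$: there are $d\geq 0$ and $\tau>0$ such that for all $n\in\mathbb N$, $0<s<t\le\tau$ and $y\in G_n\cap(E_n)_t$ one has $y-\rho_n(\alpha_n)j_n(\alpha_n)y\in\mathcal H^n_d\big((E_n)_s\big)$; B) $j$ is $l$-tamed on the ball $\bigcup_{n,t}\{\alpha\in F_n:|\alpha|_{n,t}<r_nt^l\}$: there are a tamed sequence $(p_n)$ with $p_n^{-1}<r_n$ and constants $C,\tau>0$ such that for $n\in\mathbb N$, $0<s<t\le\tau$ and $\alpha\in F_n$, $|\alpha|_{n,t}\le (t-s)^l/p_n$ implies $N^k_s(j_n(\alpha))\le C$; C) $\mu>2k+l+m+2$. Then for every $b\in M_0$ and $A\in\,]1,2[$ there is a $1$-tamed family $u_\bullet=(u_n)$ of endomorphisms of the $E_n$ such that i) $u_n\in\mathfrak g_n$ for all $n$; ii) there is $s_0>0$ with $N^1_s(u_n)<s^{k+l+m+2}e^{-A^n}$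 for all $0<s\le s_0$ and all $n\in\mathbb N$; iii) the exponentials $e^{u_n}=\sum_i u_n^i/i!$, $n\in\mathbb N$, converge to morphisms in $\mathcal L(E_n,E_n)$, the sequence $r\,e^{u_n}\cdots e^{u_1}e^{u_0}$ converges in $\mathcal L(E_0,E_\infty)$ to a morphism $g$, and $g(a+b)-r(a)\in F_\infty$. -/

import Mathlib

open Filter Topology
open scoped ENNReal

/-- A family of extended norms `|x|_s`, indexed by a real parameter `s`. -/
abbrev Gauge (E : Type*) := ℝ → E → ℝ≥0∞

/-- An `S`-scaled vector space, i.e. a directed system of Banach spaces `E_s`, `0 < s < S`, whose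
maps `E_t → E_s` (`s < t`) are injective and of norm at most one.  As the maps are injective, the
system is the same thing as a vector space `E` (the union of the `E_s`) with the subspaces
`E_s = {x | |x|_s < ∞}`, where `|x|_s = ∞` for `x ∉ E_s`. -/
structure ScaledSpace (𝕜 : Type*) [RCLike 𝕜] (S : ℝ) (E : Type*) [AddCommGroup E] [Module 𝕜 E] where
  nrm : Gauge E
  nrm_add : ∀ s x y, 0 < s → s < S → nrm s (x + y) ≤ nrm s x + nrm s y
  nrm_smul : ∀ s (c : 𝕜) x, 0 < s → s < S → nrm s (c • x) = ENNReal.ofReal ‖c‖ * nrm s x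
  eq_zero : ∀ s x, 0 < s → s < S → nrm s x = 0 → x = 0
  mono : ∀ s t x, 0 < s → s ≤ t → t < S → nrm s x ≤ nrm t x
  exhaust : ∀ x, ∃ s, 0 < s ∧ s < S ∧ nrm s x < ⊤
  complete : ∀ s, 0 < s → s < S → ∀ x : ℕ → E, (∀ i, nrm s (x i) < ⊤) →
    (∀ ε : ℝ≥0∞, 0 < ε → ∃ N, ∀ i j, N ≤ i → N ≤ j → nrm s (x i - x j) < ε) →
    ∃ y, nrm s y < ⊤ ∧ Tendsto (fun i => nrm s (x i - y)) atTop (𝓝 0)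

/-- The canonical filtration `E^{(k)} = {x | ∃ C τ, |x|_s ≤ C s^k for all s ≤ τ}`. -/
def canonicalFiltration {E : Type*} (nE : Gauge E) (k : ℝ) : Set E :=
  {x | ∃ C τ : ℝ, 0 < τ ∧ ∀ s, 0 < s → s ≤ τ → nE s x ≤ ENNReal.ofReal (C * s ^ k)}

/-- The norm `N^k_τ(u) = sup (t-s)^k |u x|_s / (e |x|_t)` over `0 < s < t ≤ τ`, `x ∈ E_t`
(over `0 < s ≤ t ≤ τ` if `k = 0`); `u` is a `k`-bounded `τ`-morphism iff it is finite. -/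
noncomputable def boundedNorm {E F : Type*} (nE : Gauge E) (nF : Gauge F) (k τ : ℝ) (u : E → F) :
    ℝ≥0∞ :=
  ⨆ (s : ℝ) (t : ℝ) (x : E)
    (_ : 0 < s ∧ (s < t ∨ (k = 0 ∧ s = t)) ∧ t ≤ τ ∧ nE t x < ⊤),
    ENNReal.ofReal ((t - s) ^ k) * nF s (u x) / (ENNReal.ofReal (Real.exp 1) * nE t x)

/-- The operator norm of `u` from `E_t` to `F_s` (infinite if `u` does not map `E_t` to `F_s`
continuously). -/
noncomputable def levelNorm {E F : Type*} (nE : Gauge E) (nF : Gauge F) (t s : ℝ) (u : E → F) :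
    ℝ≥0∞ :=
  ⨆ (x : E) (_ : nE t x < ⊤), nF s (u x) / nE t x

/-- `u ∈ 𝓛(E, F)`: for every `t`, `u` maps `E_t` continuously to some `F_{φ(t)}`. -/
def IsMorphism {E F : Type*} (S : ℝ) (nE : Gauge E) (nF : Gauge F) (u : E → F) : Prop :=
  ∀ t, 0 < t → t < S → ∃ s, 0 < s ∧ s < S ∧ levelNorm nE nF t s u < ⊤

/-- Convergence `v_i → v` in `𝓛(E, F)`: for every `t` there is an `s` such that
the operator norms of `v_i - v` from `E_t` to `F_s` tend to zero. -/
def ConvergesTo {E F : Type*} [AddCommGroup F] (S : ℝ) (nE : Gauge E) (nF : Gauge F)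
    (v : ℕ → E → F) (w : E → F) : Prop :=
  ∀ t, 0 < t → t < S → ∃ s, 0 < s ∧ s < S ∧
    Tendsto (fun i => levelNorm nE nF t s (fun x => v i x - w x)) atTop (𝓝 0)

/-- `w = e^u`: the series `∑ u^j / j!` converges in `𝓛(E)` to the morphism `w`. -/
def IsExp {𝕜 : Type*} [RCLike 𝕜] {E : Type*} [AddCommGroup E] [Module 𝕜 E] (S : ℝ) (nE : Gauge E)
    (u w : E →ₗ[𝕜] E) : Prop :=
  IsMorphism S nE nE w ∧
    ConvergesTo S nE nE
      (fun N x => ∑ j ∈ Finset.range N, ((j.factorial : 𝕜)⁻¹) • (u ^ j) x) w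

/-- The terms `𝓗^k_d(E_t)` of the harmonic filtration. -/
def harmonicLevel {E : Type*} (nE : Gauge E) (d : ℝ) (k : ℕ) (t : ℝ) : Set E :=
  {x | nE t x < ⊤ ∧ ∀ s, 0 < s → s < t →
    nE s x ≤ ENNReal.ofReal (1 / (t - s) ^ d * (s / t) ^ (2 ^ k)) * nE t x}

/-- Tamed (increasing, positive) sequences. -/
def IsTamedSeq (p : ℕ → ℝ) : Prop :=
  Monotone p ∧ (∀ n, 0 < p n) ∧ Summable (fun n => Real.log (max 1 (p n)) / 2 ^ n)

/-- `k`-tamed morphisms: for a common `τ`, all `N^k_τ(u_n)` are finite and, for `n ∈ ℕ`,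
they are dominated by a tamed sequence. -/
def IsTamedMorphism {P Q : ℕ∞ → Type*} (S : ℝ) (nP : ∀ n, Gauge (P n)) (nQ : ∀ n, Gauge (Q n))
    (k : ℝ) (u : ∀ n, P n → Q n) : Prop :=
  ∃ τ, 0 < τ ∧ τ < S ∧ (∃ p, IsTamedSeq p ∧
      ∀ n : ℕ, boundedNorm (nP n) (nQ n) k τ (u n) ≤ ENNReal.ofReal (p n)) ∧
    boundedNorm (nP ⊤) (nQ ⊤) k τ (u ⊤) < ⊤

/-- A (nonlinear) map `f` on the ball `B(r,l)`, the set of the `x` with `|x|_{n,t} < r_n t^l` for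
some `t`, is `l`-tamed: there are a tamed sequence `p` with `1/p_n < r_n` and a constant `C` with
`|x|_{n,t} ≤ (t-s)^l / p_n → |f x|_{n,s} ≤ C`.  (Such an `x` lies in the ball, so the values of
`f` outside the ball play no role.) -/
def IsTamedMap {P Q : ℕ∞ → Type*} (S : ℝ) (nP : ∀ n, Gauge (P n)) (nQ : ∀ n, Gauge (Q n))
    (r : ℕ → ℝ) (l : ℝ) (f : ∀ n, P n → Q n) : Prop :=
  ∃ τ, 0 < τ ∧ τ < S ∧ ∃ p, IsTamedSeq p ∧ (∀ n, (p n)⁻¹ < r n) ∧ ∃ C : ℝ, 0 < C ∧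
    ∀ (n : ℕ) (s t : ℝ) (x : P n), 0 < s → s < t → t ≤ τ →
      nP n t x ≤ ENNReal.ofReal ((t - s) ^ l / p n) → nQ n s (f n x) ≤ ENNReal.ofReal C

/-- `v` is a right `d`-quasi-inverse of `u`: for a common `τ`, if `y ∈ (Q_n)_t`, `t ≤ τ`, then
`y - u v y ∈ 𝓗^n_d((Q_n)_s)` for all `s < t`. -/
def IsRightQuasiInverse {P Q : ℕ∞ → Type*} [∀ n, AddCommGroup (Q n)] (S : ℝ)
    (nQ : ∀ n, Gauge (Q n)) (d : ℝ) (u : ∀ n, P n → Q n) (v : ∀ n, Q n → P n) : Prop :=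
  ∃ τ, 0 < τ ∧ τ < S ∧ ∀ (n : ℕ) (y : Q n) (s t : ℝ), 0 < s → s < t → t ≤ τ → nQ n t y < ⊤ →
    y - u n (v n y) ∈ harmonicLevel (nQ n) d n s

/-- An `S`-Arnold space: a directed system, indexed by `ℕ ∪ {∞}`, of `S`-scaled vector spaces,
whose restriction morphisms are `0`-bounded with `N^0 ≤ 1`. -/
structure ArnoldSpace (𝕜 : Type*) [RCLike 𝕜] (S : ℝ) (E : ℕ∞ → Type*)
    [∀ n, AddCommGroup (E n)] [∀ n, Module 𝕜 (E n)] where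
  scaled : ∀ n, ScaledSpace 𝕜 S (E n)
  res : ∀ {i j : ℕ∞}, i ≤ j → (E i →ₗ[𝕜] E j)
  res_self : ∀ i (x : E i), res (le_refl i) x = x
  res_res : ∀ {i j k : ℕ∞} (hij : i ≤ j) (hjk : j ≤ k) (x : E i),
    res hjk (res hij x) = res (hij.trans hjk) x
  res_bounded : ∀ {i j : ℕ∞} (h : i ≤ j) (τ : ℝ), 0 < τ → τ < S →
    boundedNorm (scaled i).nrm (scaled j).nrm 0 τ (res h) ≤ 1

namespace ArnoldSpace

variable {𝕜 : Type*} [RCLike 𝕜] {S : ℝ} {E : ℕ∞ → Type*}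
  [∀ n, AddCommGroup (E n)] [∀ n, Module 𝕜 (E n)]

/-- `|x|_{n,s}`. -/
def nrm (X : ArnoldSpace 𝕜 S E) (n : ℕ∞) : Gauge (E n) := (X.scaled n).nrm

/-- The norms induced on a subspace. -/
def subNrm (X : ArnoldSpace 𝕜 S E) (M : ∀ n, Submodule 𝕜 (E n)) (n : ℕ∞) : Gauge (M n) :=
  fun s x => X.nrm n s (x : E n)

/-- The scaling `s ↦ N^1_s` of the space of `1`-bounded morphisms of `E_n`. -/
noncomputable def endNrm (X : ArnoldSpace 𝕜 S E) (n : ℕ∞) : Gauge (E n →ₗ[𝕜] E n) :=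
  fun s u => boundedNorm (X.nrm n) (X.nrm n) 1 s u

/-- The components of `E_•^{(μ)}`; the condition bears on the indices `n ∈ ℕ` only. -/
def filtration (X : ArnoldSpace 𝕜 S E) (μ : ℝ) (n : ℕ∞) : Set (E n) :=
  {x | n ≠ ⊤ → x ∈ canonicalFiltration (X.nrm n) μ}

/-- `M_•` is a closed subspace of `W_•`: it is contained in `W_•`, stable under restrictions, and,
for all `n` and `s`, `M_n ∩ (E_n)_s` is closed in `W_n ∩ (E_n)_s` for the norm `|·|_{n,s}`. -/
structure IsClosedSubspace (X : ArnoldSpace 𝕜 S E) (M : ∀ n, Submodule 𝕜 (E n))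
    (W : ∀ n, Set (E n)) : Prop where
  subset : ∀ n, (M n : Set (E n)) ⊆ W n
  res_mem : ∀ {i j : ℕ∞} (h : i ≤ j) (x : E i), x ∈ M i → X.res h x ∈ M j
  closed : ∀ n s, 0 < s → s < S → ∀ (x : ℕ → E n) (y : E n),
    (∀ i, x i ∈ M n ∧ X.nrm n s (x i) < ⊤) → y ∈ W n →
    Tendsto (fun i => X.nrm n s (x i - y)) atTop (𝓝 0) → y ∈ M n

/-- `F_•, G_•` define an `m`-bounded splitting of `M_•`. -/
structure IsBoundedSplitting (X : ArnoldSpace 𝕜 S E) (M F G : ∀ n, Submodule 𝕜 (E n)) (m : ℝ) :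
    Prop where
  closed_left : X.IsClosedSubspace F (fun n => (M n : Set (E n)))
  closed_right : X.IsClosedSubspace G (fun n => (M n : Set (E n)))
  disjoint : ∀ n, Disjoint (F n) (G n)
  projections : ∃ (πF : ∀ n, M n →ₗ[𝕜] F n) (πG : ∀ n, M n →ₗ[𝕜] G n),
    (∀ n (x : M n), (x : E n) = (πF n x : E n) + (πG n x : E n)) ∧
    ∃ τ, 0 < τ ∧ τ < S ∧ ∀ n,
      boundedNorm (X.subNrm M n) (X.subNrm F n) m τ (πF n) ≤ 1 ∧
      boundedNorm (X.subNrm M n) (X.subNrm G n) m τ (πG n) ≤ 1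

/-- The components `𝔤_n` of a vector space `𝔤_•` of morphisms `u_• = (u_n)`. -/
abbrev component (𝔤 : Submodule 𝕜 (∀ n, E n →ₗ[𝕜] E n)) (n : ℕ∞) :
    Submodule 𝕜 (E n →ₗ[𝕜] E n) :=
  𝔤.map (LinearMap.proj n)

/-- The scaling `s ↦ N^1_s` of `𝔤_n`. -/
noncomputable def componentNrm (X : ArnoldSpace 𝕜 S E) (𝔤 : Submodule 𝕜 (∀ n, E n →ₗ[𝕜] E n))
    (n : ℕ∞) : Gauge (component 𝔤 n) :=
  fun s u => X.endNrm n s (u : E n →ₗ[𝕜] E n)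

/-- The evaluation `𝔤_n → G_n`, `u ↦ u x`. -/
def evalMap (𝔤 : Submodule 𝕜 (∀ n, E n →ₗ[𝕜] E n)) (G : ∀ n, Submodule 𝕜 (E n)) (n : ℕ∞) (x : E n)
    (h : ∀ u ∈ component 𝔤 n, u x ∈ G n) : component 𝔤 n →ₗ[𝕜] G n where
  toFun u := ⟨(u : E n →ₗ[𝕜] E n) x, h u u.2⟩
  map_add' _ _ := rfl
  map_smul' _ _ := rfl

/-- Elements of `M_•` which are bounded at a common level `t`. -/
def IsBoundedElement (X : ArnoldSpace 𝕜 S E) (M : ∀ n, Submodule 𝕜 (E n)) (α : ∀ n, M n) : Prop :=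
  ∃ t, 0 < t ∧ t < S ∧ ∃ C : ℝ, ∀ n, X.subNrm M n t (α n) ≤ ENNReal.ofReal C

/-- The products `e_n ⋯ e_1 e_0 : E_0 → E_n`, restrictions being understood. -/
def partialProd (X : ArnoldSpace 𝕜 S E) (e : ∀ n : ℕ, E n →ₗ[𝕜] E n) :
    ∀ n : ℕ, E ((0 : ℕ) : ℕ∞) →ₗ[𝕜] E (n : ℕ∞)
  | 0 => e 0
  | n + 1 => e (n + 1) ∘ₗ X.res (Nat.cast_le.2 (Nat.le_succ n)) ∘ₗ X.partialProd e n

/-- The restriction `r_n : E_0 → E_n`, `n ∈ ℕ ∪ {∞}`. -/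
def resZero (X : ArnoldSpace 𝕜 S E) (n : ℕ∞) : E ((0 : ℕ) : ℕ∞) →ₗ[𝕜] E n :=
  X.res (by simp)

end ArnoldSpace

/-! The proof is a Newton iteration in which the F-component never moves. Write b = β + γ₀ with β in
F₀ and γ₀ in G₀, and let w_n be the restriction of a + β. Elements of 𝔤_n send w_n and G_n into G_n,
so e^u (w_n + y) - w_n stays in G_n for y in G_n (`exp_sub_mem`). It is enough to drive this G-part
to zero, using j at the single argument α = β; in the limit g(a + b) = r(a) + r(β).

One step takes u = j_n(α_n)(-y), so that u w = h - y, where h is the harmonic error of the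
quasi-inverse. Regrouping the exponential series gives e^u (w + y) - w = Σ ((1/i! - 1/(i+1)!) u^i y
+ u^i h / (i+1)!). Its term i = 0 is h; the other terms are quadratically small.

The G-part is controlled at all levels s ≤ T_i at once, by s^ν (s/T_i)^(2^i δ) e^(-D_i) with ν =
2k+l+m+2 and δ = μ - ν > 0. Squaring doubles the exponent 2^i δ and, since ν ≥ 2k+2, keeps the
factor s^ν after two divisions by s^(k+1). Replacing T_i by T_i e^(-g_i) then gains e^(-2^i δ g_i),
which is made equal to e^(-D_(i+1)). The D_i outweigh the tamed bounds of j, A^n and some geometric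
factors. Since Σ D_i / 2^i converges, so does Σ g_i, and the T_i stay above some T' > 0.

The harmonic error gains (s/t)^(2^n), which must beat negative powers of T_i. The iteration
therefore starts at a large index N, with u_n = 0 before. No smallness of b is needed: the extra
order δ makes the initial majorant small once T_0 is small, at a cost in -log T_0 of only o(2^N)
(`exists_stepCondition`). `step_bound` is one step, and `exists_infinite_product` gives convergence
of the product. -/

/-! ### Elementary estimates for bounded maps -/

theorem nrm_apply_le_of_boundedNorm_le {E F : Type*} {nE : Gauge E} {nF : Gauge F} {k τ N B : ℝ}
    {u : E → F} (hu : boundedNorm nE nF k τ u ≤ ENNReal.ofReal N) (hN : 0 ≤ N) {s t : ℝ} {x : E}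
    (hs : 0 < s) (hst : s < t) (ht : t ≤ τ) (hx : nE t x ≤ ENNReal.ofReal B)
    (hzero : nE t x = 0 → nF s (u x) = 0) :
    nF s (u x) ≤ ENNReal.ofReal (Real.exp 1 * N * B / (t - s) ^ k) := by
  by_cases h0 : nE t x = 0
  · simp [hzero h0]
  have hpos : 0 < (t - s) ^ k := Real.rpow_pos_of_pos (by linarith) _
  have hfin : nE t x < ⊤ := hx.trans_lt ENNReal.ofReal_lt_top
  have h1 : ENNReal.ofReal ((t - s) ^ k) * nF s (u x) / (ENNReal.ofReal (Real.exp 1) * nE t x)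
      ≤ ENNReal.ofReal N := by
    refine le_trans ?_ hu
    unfold boundedNorm
    exact le_iSup_of_le s (le_iSup_of_le t (le_iSup_of_le x
      (le_iSup_of_le ⟨hs, Or.inl hst, ht, hfin⟩ le_rfl)))
  rw [ENNReal.div_le_iff (by simp [h0, Real.exp_pos])
    (ENNReal.mul_ne_top ENNReal.ofReal_ne_top hfin.ne)] at h1
  rw [ENNReal.ofReal_div_of_pos hpos, ENNReal.le_div_iff_mul_le
    (Or.inl (by simpa using hpos)) (Or.inl ENNReal.ofReal_ne_top), mul_comm]
  refine h1.trans ?_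
  rw [mul_comm (Real.exp 1) N, mul_assoc, ENNReal.ofReal_mul hN,
    ENNReal.ofReal_mul (Real.exp_pos 1).le]
  gcongr

theorem boundedNorm_mono {E F : Type*} {nE : Gauge E} {nF : Gauge F} {k σ τ : ℝ} {u : E → F}
    (h : σ ≤ τ) : boundedNorm nE nF k σ u ≤ boundedNorm nE nF k τ u := by
  unfold boundedNorm
  refine iSup_mono fun s => iSup_mono fun t => iSup_mono fun x => ?_
  exact iSup_mono' fun hh => ⟨⟨hh.1, hh.2.1, hh.2.2.1.trans h, hh.2.2.2⟩, le_rfl⟩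

theorem levelNorm_le {E F : Type*} {nE : Gauge E} {nF : Gauge F} {t s K : ℝ} (hK : 0 ≤ K)
    {u : E → F}
    (h : ∀ x B, 0 ≤ B → nE t x ≤ ENNReal.ofReal B → nF s (u x) ≤ ENNReal.ofReal (K * B)) :
    levelNorm nE nF t s u ≤ ENNReal.ofReal K := by
  unfold levelNorm
  refine iSup_le fun x => iSup_le fun hx => ENNReal.div_le_of_le_mul ?_
  have := h x (nE t x).toReal ENNReal.toReal_nonneg (ENNReal.ofReal_toReal hx.ne).ge
  rwa [ENNReal.ofReal_mul hK, ENNReal.ofReal_toReal hx.ne] at this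

/-! ### Convergence in scaled vector spaces -/

namespace ScaledSpace

variable {𝕜 : Type*} [RCLike 𝕜] {S : ℝ} {E : Type*} [AddCommGroup E] [Module 𝕜 E]

theorem S_pos (X : ScaledSpace 𝕜 S E) : 0 < S := by
  obtain ⟨s, h1, h2, -⟩ := X.exhaust 0
  linarith

variable (X : ScaledSpace 𝕜 S E)

theorem nrm_zero {s : ℝ} (hs : 0 < s) (hS : s < S) : X.nrm s 0 = 0 := by
  simpa using X.nrm_smul s 0 0 hs hS

theorem nrm_neg {s : ℝ} (hs : 0 < s) (hS : s < S) (x : E) : X.nrm s (-x) = X.nrm s x := by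
  simpa using X.nrm_smul s (-1) x hs hS

theorem nrm_sub_le {s : ℝ} (hs : 0 < s) (hS : s < S) (x y : E) :
    X.nrm s (x - y) ≤ X.nrm s x + X.nrm s y := by
  rw [sub_eq_add_neg, ← X.nrm_neg hs hS y]
  exact X.nrm_add s _ _ hs hS

theorem nrm_sub_comm {s : ℝ} (hs : 0 < s) (hS : s < S) (x y : E) :
    X.nrm s (x - y) = X.nrm s (y - x) := by
  rw [← X.nrm_neg hs hS, neg_sub]

theorem nrm_add_le_ofReal {s B C : ℝ} (hs : 0 < s) (hS : s < S) {x y : E} (hB : 0 ≤ B) (hC : 0 ≤ C)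
    (hx : X.nrm s x ≤ ENNReal.ofReal B) (hy : X.nrm s y ≤ ENNReal.ofReal C) :
    X.nrm s (x + y) ≤ ENNReal.ofReal (B + C) := by
  rw [ENNReal.ofReal_add hB hC]
  exact (X.nrm_add s x y hs hS).trans (add_le_add hx hy)

theorem nrm_sub_le_ofReal {s B C : ℝ} (hs : 0 < s) (hS : s < S) {x y : E} (hB : 0 ≤ B) (hC : 0 ≤ C)
    (hx : X.nrm s x ≤ ENNReal.ofReal B) (hy : X.nrm s y ≤ ENNReal.ofReal C) :
    X.nrm s (x - y) ≤ ENNReal.ofReal (B + C) := by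
  rw [sub_eq_add_neg]
  exact X.nrm_add_le_ofReal hs hS hB hC hx (by rwa [X.nrm_neg hs hS])

theorem nrm_smul_le_ofReal {s B c : ℝ} (hs : 0 < s) (hS : s < S) {x : E} {r : 𝕜} (hr : ‖r‖ ≤ c)
    (hx : X.nrm s x ≤ ENNReal.ofReal B) : X.nrm s (r • x) ≤ ENNReal.ofReal (c * B) := by
  rw [X.nrm_smul s r x hs hS, ENNReal.ofReal_mul ((norm_nonneg r).trans hr)]
  gcongr

/-- Convergence of a sequence in one of the Banach spaces `E_s`. -/
def Converges (x : ℕ → E) (y : E) : Prop :=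
  ∃ s, 0 < s ∧ s < S ∧ Tendsto (fun i => X.nrm s (x i - y)) atTop (𝓝 0)

variable {X}

theorem tendsto_nrm_mono {s t : ℝ} (hs : 0 < s) (hst : s ≤ t) (ht : t < S) {x : ℕ → E} {y : E}
    (h : Tendsto (fun i => X.nrm t (x i - y)) atTop (𝓝 0)) :
    Tendsto (fun i => X.nrm s (x i - y)) atTop (𝓝 0) :=
  tendsto_of_tendsto_of_tendsto_of_le_of_le tendsto_const_nhds h (fun _ => zero_le)
    fun _ => X.mono s t _ hs hst ht

theorem tendsto_nrm_add {s : ℝ} (hs : 0 < s) (hS : s < S) {x x' : ℕ → E} {y y' : E}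
    (h : Tendsto (fun i => X.nrm s (x i - y)) atTop (𝓝 0))
    (h' : Tendsto (fun i => X.nrm s (x' i - y')) atTop (𝓝 0)) :
    Tendsto (fun i => X.nrm s (x i + x' i - (y + y'))) atTop (𝓝 0) := by
  have := h.add h'
  rw [add_zero] at this
  refine tendsto_of_tendsto_of_tendsto_of_le_of_le tendsto_const_nhds this (fun _ => zero_le)
    fun i => ?_
  change X.nrm s (x i + x' i - (y + y')) ≤ _
  rw [add_sub_add_comm]
  exact X.nrm_add s _ _ hs hS

theorem Converges.add {x x' : ℕ → E} {y y' : E} (h : X.Converges x y) (h' : X.Converges x' y') :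
    X.Converges (fun i => x i + x' i) (y + y') := by
  obtain ⟨s, hs, hS, h⟩ := h
  obtain ⟨s', hs', hS', h'⟩ := h'
  have h0 := lt_min hs hs'
  have h1 := (min_le_left s s').trans_lt hS
  exact ⟨min s s', h0, h1, tendsto_nrm_add h0 h1 (tendsto_nrm_mono h0 (min_le_left _ _) hS h)
    (tendsto_nrm_mono h0 (min_le_right _ _) hS' h')⟩

theorem Converges.const_smul {x : ℕ → E} {y : E} (h : X.Converges x y) (c : 𝕜) :
    X.Converges (fun i => c • x i) (c • y) := by
  obtain ⟨s, hs, hS, h⟩ := h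
  refine ⟨s, hs, hS, ?_⟩
  have := ENNReal.Tendsto.const_mul (a := ENNReal.ofReal ‖c‖) h (Or.inr ENNReal.ofReal_ne_top)
  rw [mul_zero] at this
  refine this.congr fun i => ?_
  rw [← smul_sub, X.nrm_smul s c _ hs hS]

theorem Converges.of_eq (X : ScaledSpace 𝕜 S E) (y : E) : X.Converges (fun _ => y) y := by
  obtain ⟨s, hs, hS, -⟩ := X.exhaust 0
  exact ⟨s, hs, hS, by simp [X.nrm_zero hs hS]⟩

theorem Converges.sub {x x' : ℕ → E} {y y' : E} (h : X.Converges x y) (h' : X.Converges x' y') :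
    X.Converges (fun i => x i - x' i) (y - y') := by
  have := h.add (h'.const_smul (-1))
  simpa [← sub_eq_add_neg] using this

theorem Converges.comp_succ {x : ℕ → E} {y : E} (h : X.Converges x y) :
    X.Converges (fun i => x (i + 1)) y := by
  obtain ⟨s, hs, hS, h⟩ := h
  exact ⟨s, hs, hS, h.comp (tendsto_add_atTop_nat 1)⟩

theorem Converges.unique {x : ℕ → E} {y y' : E} (h : X.Converges x y) (h' : X.Converges x y') :
    y = y' := by
  obtain ⟨s, hs, hS, h⟩ := h.sub h'
  rw [← sub_eq_zero]
  refine X.eq_zero s _ hs hS ?_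
  have h2 : (fun i => X.nrm s (x i - x i - (y - y'))) = fun _ => X.nrm s (y - y') := by
    funext i
    rw [sub_self, zero_sub, X.nrm_neg hs hS]
  rw [h2] at h
  exact tendsto_nhds_unique tendsto_const_nhds h

theorem exists_limit_of_geometric {s B q : ℝ} (hs : 0 < s) (hS : s < S) (hB : 0 ≤ B) (hq0 : 0 ≤ q)
    (hq : q ≤ 1 / 2) {x : ℕ → E} (hx : X.nrm s (x 0) < ⊤)
    (h : ∀ i, X.nrm s (x (i + 1) - x i) ≤ ENNReal.ofReal (B * q ^ i)) :
    ∃ y, Tendsto (fun i => X.nrm s (x i - y)) atTop (𝓝 0) ∧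
      ∀ i, X.nrm s (x i - y) ≤ ENNReal.ofReal (2 * B * q ^ i) := by
  have hq1 : q ≤ 1 := by linarith
  -- The telescoping form makes the induction close: for q ≤ 1/2 one has q^j ≤ 2 (q^j - q^(j+1)).
  have h1 : ∀ i n, X.nrm s (x (i + n) - x i) ≤
      ENNReal.ofReal (2 * B * (q ^ i - q ^ (i + n))) := by
    intro i n
    induction n with
    | zero => simp [X.nrm_zero hs hS]
    | succ n ih =>
      have e : x (i + (n + 1)) - x i = (x (i + n + 1) - x (i + n)) + (x (i + n) - x i) := by
        rw [add_assoc]; abel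
      rw [e]
      refine (X.nrm_add_le_ofReal hs hS (by positivity) ?_ (h _) ih).trans
        (ENNReal.ofReal_le_ofReal ?_)
      · have := pow_le_pow_of_le_one hq0 hq1 (Nat.le_add_right i n)
        exact mul_nonneg (by positivity) (by linarith)
      · have h0 : 0 ≤ B * q ^ (i + n) := by positivity
        have : q ^ (i + (n + 1)) = q ^ (i + n) * q := by rw [← add_assoc, pow_succ]
        rw [this]
        nlinarith
  have h2 : ∀ i n, i ≤ n → X.nrm s (x n - x i) ≤ ENNReal.ofReal (2 * B * q ^ i) := by
    intro i n hin
    obtain ⟨m, rfl⟩ := Nat.exists_eq_add_of_le hin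
    refine (h1 i m).trans (ENNReal.ofReal_le_ofReal ?_)
    have : 0 ≤ q ^ (i + m) := by positivity
    exact mul_le_mul_of_nonneg_left (by linarith) (by positivity)
  have hlim : Tendsto (fun i => ENNReal.ofReal (2 * B * q ^ i)) atTop (𝓝 0) := by
    rw [← ENNReal.ofReal_zero]
    refine ENNReal.tendsto_ofReal ?_
    simpa using (tendsto_pow_atTop_nhds_zero_of_lt_one hq0 (by linarith)).const_mul (2 * B)
  have hfin : ∀ i, X.nrm s (x i) < ⊤ := by
    intro i
    have : x i = (x i - x 0) + x 0 := by abel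
    rw [this]
    exact (X.nrm_add s _ _ hs hS).trans_lt
      (ENNReal.add_lt_top.2 ⟨(h2 0 i (Nat.zero_le _)).trans_lt ENNReal.ofReal_lt_top, hx⟩)
  obtain ⟨y, -, hy⟩ := X.complete s hs hS x hfin (by
    intro ε hε
    obtain ⟨N, hN⟩ := (hlim.eventually (gt_mem_nhds hε)).exists_forall_of_atTop
    refine ⟨N, fun i j hi hj => ?_⟩
    rcases le_total i j with hij | hij
    · rw [X.nrm_sub_comm hs hS]
      exact (h2 i j hij).trans_lt (hN i hi)
    · exact (h2 j i hij).trans_lt (hN j hj))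
  refine ⟨y, hy, fun i => ?_⟩
  have h3 : Tendsto (fun n => ENNReal.ofReal (2 * B * q ^ i) + X.nrm s (x n - y)) atTop
      (𝓝 (ENNReal.ofReal (2 * B * q ^ i) + 0)) := tendsto_const_nhds.add hy
  rw [add_zero] at h3
  refine ge_of_tendsto h3 (eventually_atTop.2 ⟨i, fun n hn => ?_⟩)
  have e : x i - y = (x i - x n) + (x n - y) := by abel
  rw [e]
  refine (X.nrm_add s _ _ hs hS).trans (add_le_add_left ?_ _)
  rw [X.nrm_sub_comm hs hS]
  exact h2 i n hn

/-- Convergence may be known only at some uncontrolled lower level. Completeness gives a limit at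
the level s itself, and injectivity of the maps E_t → E_s forces the two limits to agree. -/
theorem Converges.nrm_sub_le_of_geometric {s B q : ℝ} (hs : 0 < s) (hS : s < S) (hB : 0 ≤ B)
    (hq0 : 0 ≤ q) (hq : q ≤ 1 / 2) {x : ℕ → E} {y : E} (hx : X.nrm s (x 0) < ⊤)
    (h : ∀ i, X.nrm s (x (i + 1) - x i) ≤ ENNReal.ofReal (B * q ^ i)) (hy : X.Converges x y) :
    Tendsto (fun i => X.nrm s (x i - y)) atTop (𝓝 0) ∧
      ∀ i, X.nrm s (x i - y) ≤ ENNReal.ofReal (2 * B * q ^ i) := by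
  obtain ⟨z, hz, hz'⟩ := exists_limit_of_geometric hs hS hB hq0 hq hx h
  obtain rfl : z = y := Converges.unique ⟨s, hs, hS, hz⟩ hy
  exact ⟨hz, hz'⟩

/-- A sequence of linear maps which converges geometrically on every `E_t` has a limit
in `𝓛(E, F)`. -/
theorem exists_limit_morphism {F : Type*} [AddCommGroup F] [Module 𝕜 F] (X : ScaledSpace 𝕜 S E)
    (Y : ScaledSpace 𝕜 S F) (v : ℕ → E →ₗ[𝕜] F)
    (h : ∀ t, 0 < t → t < S → ∃ s, 0 < s ∧ s < S ∧ ∃ C : ℝ, 0 ≤ C ∧ ∀ x B, 0 ≤ B →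
      X.nrm t x ≤ ENNReal.ofReal B → Y.nrm s (v 0 x) ≤ ENNReal.ofReal (C * B) ∧
      ∀ i, Y.nrm s (v (i + 1) x - v i x) ≤ ENNReal.ofReal (C * B * (1 / 2) ^ i)) :
    ∃ w : E →ₗ[𝕜] F, IsMorphism S X.nrm Y.nrm w ∧ ConvergesTo S X.nrm Y.nrm (fun i x => v i x) w ∧
      ∀ x, Y.Converges (fun i => v i x) (w x) := by
  have hex : ∀ x, ∃ y, Y.Converges (fun i => v i x) y := by
    intro x
    obtain ⟨t, ht, htS, hx⟩ := X.exhaust x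
    obtain ⟨s, hs, hS, C, hC, hh⟩ := h t ht htS
    obtain ⟨h0, h1⟩ := hh x (X.nrm t x).toReal ENNReal.toReal_nonneg
      (ENNReal.ofReal_toReal hx.ne).ge
    obtain ⟨y, hy, -⟩ := exists_limit_of_geometric (x := fun i => v i x) hs hS
      (mul_nonneg hC ENNReal.toReal_nonneg) (by norm_num) le_rfl
      (h0.trans_lt ENNReal.ofReal_lt_top) h1
    exact ⟨y, s, hs, hS, hy⟩
  choose w hw using hex
  let W : E →ₗ[𝕜] F :=
    { toFun := w
      map_add' := fun x y => (hw (x + y)).unique (by simpa using (hw x).add (hw y))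
      map_smul' := fun c x => (hw (c • x)).unique (by simpa using (hw x).const_smul c) }
  have key : ∀ t, 0 < t → t < S → ∃ s, 0 < s ∧ s < S ∧ ∃ C : ℝ, 0 ≤ C ∧ ∀ x B, 0 ≤ B →
      X.nrm t x ≤ ENNReal.ofReal B → Y.nrm s (v 0 x) ≤ ENNReal.ofReal (C * B) ∧
      ∀ i, Y.nrm s (v i x - w x) ≤ ENNReal.ofReal (2 * C * (1 / 2) ^ i * B) := by
    intro t ht htS
    obtain ⟨s, hs, hS, C, hC, hh⟩ := h t ht htS
    refine ⟨s, hs, hS, C, hC, fun x B hB hx => ?_⟩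
    obtain ⟨h0, h1⟩ := hh x B hB hx
    refine ⟨h0, fun i => ?_⟩
    refine ((hw x).nrm_sub_le_of_geometric hs hS (mul_nonneg hC hB) (by norm_num) le_rfl
      (h0.trans_lt ENNReal.ofReal_lt_top) h1).2 i |>.trans_eq ?_
    congr 1
    ring
  refine ⟨W, ?_, ?_, hw⟩
  · intro t ht htS
    obtain ⟨s, hs, hS, C, hC, hh⟩ := key t ht htS
    refine ⟨s, hs, hS, (levelNorm_le (K := 3 * C) (by positivity) ?_).trans_lt
      ENNReal.ofReal_lt_top⟩
    intro x B hB hx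
    obtain ⟨h0, h1⟩ := hh x B hB hx
    have := Y.nrm_sub_le_ofReal hs hS (by positivity) (by positivity) h0 (h1 0)
    rw [sub_sub_cancel] at this
    refine this.trans_eq ?_
    congr 1
    ring
  · intro t ht htS
    obtain ⟨s, hs, hS, C, hC, hh⟩ := key t ht htS
    refine ⟨s, hs, hS, ?_⟩
    have hlim : Tendsto (fun i : ℕ => ENNReal.ofReal (2 * C * (1 / 2) ^ i)) atTop (𝓝 0) := by
      rw [← ENNReal.ofReal_zero]
      refine ENNReal.tendsto_ofReal ?_
      simpa using (tendsto_pow_atTop_nhds_zero_of_lt_one (r := (1 / 2 : ℝ)) (by norm_num)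
        (by norm_num)).const_mul (2 * C)
    refine tendsto_of_tendsto_of_tendsto_of_le_of_le tendsto_const_nhds hlim (fun _ => zero_le)
      fun i => levelNorm_le (by positivity) fun x B hB hx => (hh x B hB hx).2 i

end ScaledSpace

/-! ### Exponentials of 1-bounded morphisms -/

namespace ScaledSpace

variable {𝕜 : Type*} [RCLike 𝕜] {S : ℝ} {E : Type*} [AddCommGroup E] [Module 𝕜 E]
  {X : ScaledSpace 𝕜 S E}

theorem nrm_apply_le {E' : Type*} [AddCommGroup E'] [Module 𝕜 E'] {Y : ScaledSpace 𝕜 S E'}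
    {u : E →ₗ[𝕜] E'} {k τ N B s t : ℝ}
    (hu : boundedNorm X.nrm Y.nrm k τ u ≤ ENNReal.ofReal N) (hN : 0 ≤ N) (hs : 0 < s) (hst : s < t)
    (ht : t ≤ τ) (hS : t < S) {x : E} (hx : X.nrm t x ≤ ENNReal.ofReal B) :
    Y.nrm s (u x) ≤ ENNReal.ofReal (Real.exp 1 * N * B / (t - s) ^ k) :=
  nrm_apply_le_of_boundedNorm_le hu hN hs hst ht hx fun h0 => by
    rw [X.eq_zero t x (hs.trans hst) hS h0, map_zero, Y.nrm_zero hs (hst.trans hS)]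

/-- Divide [s, t] into i equal intervals and lose one of them, of length (t - s)/i, at each
application of u. -/
theorem nrm_pow_le {u : E →ₗ[𝕜] E} {N B s t : ℝ}
    (hu : boundedNorm X.nrm X.nrm 1 t u ≤ ENNReal.ofReal N) (hN : 0 ≤ N) (hs : 0 < s) (hst : s < t)
    (hS : t < S) {x : E} (hx : X.nrm t x ≤ ENNReal.ofReal B) (i : ℕ) :
    X.nrm s ((u ^ i) x) ≤ ENNReal.ofReal ((Real.exp 1 * N * i / (t - s)) ^ i * B) := by
  rcases Nat.eq_zero_or_pos i with rfl | hi
  · simpa using (X.mono s t x hs hst.le hS).trans hx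
  have hi' : (0 : ℝ) < i := by exact_mod_cast hi
  have hts : 0 < t - s := by linarith
  have key : ∀ m : ℕ, m ≤ i → X.nrm (t - m * ((t - s) / i)) ((u ^ m) x) ≤
      ENNReal.ofReal ((Real.exp 1 * N * i / (t - s)) ^ m * B) := by
    intro m
    induction m with
    | zero => intro _; simpa using hx
    | succ m ih =>
      intro hm
      have hm' : ((m : ℝ) + 1) ≤ i := by exact_mod_cast hm
      have hd : 0 < (t - s) / i := by positivity
      have h1 : ((m : ℝ) + 1) * ((t - s) / i) ≤ t - s := by
        calc ((m : ℝ) + 1) * ((t - s) / i) ≤ i * ((t - s) / i) := by gcongr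
          _ = t - s := by field_simp
      have h2 : 0 ≤ (m : ℝ) * ((t - s) / i) := by positivity
      have h3 := nrm_apply_le (s := t - ((m : ℝ) + 1) * ((t - s) / i)) hu hN (by linarith)
        (by nlinarith) (by linarith) (by linarith) (ih (by omega))
      rw [pow_succ', Module.End.mul_apply]
      push_cast
      refine h3.trans_eq ?_
      congr 1
      rw [Real.rpow_one, pow_succ]
      have : t - ↑m * ((t - s) / ↑i) - (t - (↑m + 1) * ((t - s) / ↑i)) = (t - s) / i := by ring
      rw [this]
      field_simp
  have := key i le_rfl
  rwa [mul_div_cancel₀ _ hi'.ne', sub_sub_cancel] at this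

/-- Since i^i / i! ≤ e^i, the loss in `nrm_pow_le` is absorbed by the factorial and the exponential
series is dominated by a geometric one of ratio e² N / (t - s). -/
theorem nrm_smul_pow_le {u : E →ₗ[𝕜] E} {N B q s t : ℝ}
    (hu : boundedNorm X.nrm X.nrm 1 t u ≤ ENNReal.ofReal N) (hN : 0 ≤ N) (hs : 0 < s) (hst : s < t)
    (hS : t < S) (hq : Real.exp 1 ^ 2 * N / (t - s) ≤ q) (hB : 0 ≤ B) {x : E}
    (hx : X.nrm t x ≤ ENNReal.ofReal B) (i : ℕ) {c : 𝕜} (hc : ‖c‖ ≤ (i.factorial : ℝ)⁻¹) :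
    X.nrm s (c • (u ^ i) x) ≤ ENNReal.ofReal (B * q ^ i) := by
  refine (X.nrm_smul_le_ofReal hs (hst.trans hS) hc (nrm_pow_le hu hN hs hst hS hx i)).trans
    (ENNReal.ofReal_le_ofReal ?_)
  have hts : 0 < t - s := by linarith
  have h1 : (i : ℝ) ^ i / i.factorial ≤ Real.exp 1 ^ i := by
    rw [← Real.exp_nat_mul, mul_one]
    exact Real.pow_div_factorial_le_exp _ (Nat.cast_nonneg i) i
  have h2 : (i.factorial : ℝ)⁻¹ * ((Real.exp 1 * N * i / (t - s)) ^ i * B) =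
      B * ((Real.exp 1 * N / (t - s)) ^ i * ((i : ℝ) ^ i / i.factorial)) := by
    rw [mul_div_right_comm, mul_pow]
    ring
  rw [h2]
  refine mul_le_mul_of_nonneg_left ?_ hB
  calc (Real.exp 1 * N / (t - s)) ^ i * ((i : ℝ) ^ i / i.factorial)
      ≤ (Real.exp 1 * N / (t - s)) ^ i * Real.exp 1 ^ i := by gcongr
    _ = (Real.exp 1 ^ 2 * N / (t - s)) ^ i := by rw [← mul_pow]; congr 1; ring
    _ ≤ q ^ i := by gcongr

/-- `w` is the pointwise sum of the exponential series of `u`. -/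
def IsPointwiseExp (X : ScaledSpace 𝕜 S E) (u w : E →ₗ[𝕜] E) : Prop :=
  ∀ x, X.Converges (fun J => ∑ j ∈ Finset.range J, ((j.factorial : 𝕜)⁻¹) • (u ^ j) x) (w x)

theorem norm_inv_factorial (i : ℕ) : ‖((i.factorial : 𝕜)⁻¹)‖ = (i.factorial : ℝ)⁻¹ := by
  rw [norm_inv, RCLike.norm_natCast]

theorem exists_exp {u : E →ₗ[𝕜] E}
    (hu : u ∈ canonicalFiltration
      (fun s (u : E →ₗ[𝕜] E) => boundedNorm X.nrm X.nrm 1 s u) 2) :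
    ∃ w : E →ₗ[𝕜] E, IsExp S X.nrm u w ∧ X.IsPointwiseExp u w := by
  obtain ⟨C, τ, hτ, hC⟩ := hu
  obtain ⟨w, h1, h2, h3⟩ := exists_limit_morphism X X
    (fun J => ∑ j ∈ Finset.range J, ((j.factorial : 𝕜)⁻¹) • u ^ j) (by
      intro t ht htS
      set c : ℝ := max C 0
      have hc : 0 ≤ c := le_max_right _ _
      -- Between t' and t'/2 the ratio of the series is at most e² c t'² / (t'/2) = 2 e² c t'. The
      -- order two of u at 0 thus gives convergence at every small level.
      set t' : ℝ := min t (min τ (4 * (Real.exp 1 ^ 2 * c + 1))⁻¹)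
      have ht' : 0 < t' := by positivity
      have h1 : t' ≤ t := min_le_left _ _
      have h2 : t' ≤ τ := (min_le_right _ _).trans (min_le_left _ _)
      have h3 : t' ≤ (4 * (Real.exp 1 ^ 2 * c + 1))⁻¹ := (min_le_right _ _).trans (min_le_right _ _)
      refine ⟨t' / 2, by positivity, by linarith, 1, zero_le_one, fun x B hB hx => ⟨?_, ?_⟩⟩
      · simp [X.nrm_zero (half_pos ht') (by linarith)]
      · intro i
        have hN : boundedNorm X.nrm X.nrm 1 t' u ≤ ENNReal.ofReal (c * t' ^ 2) := by
          refine (hC t' ht' h2).trans (ENNReal.ofReal_le_ofReal ?_)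
          rw [Real.rpow_two]
          gcongr
          exact le_max_left _ _
        have hq : Real.exp 1 ^ 2 * (c * t' ^ 2) / (t' - t' / 2) ≤ 1 / 2 := by
          have h4 : Real.exp 1 ^ 2 * (c * t' ^ 2) / (t' - t' / 2) =
              2 * (Real.exp 1 ^ 2 * c) * t' := by
            rw [sub_half]; field_simp
          have h5 : 0 < Real.exp 1 ^ 2 * c + 1 := by positivity
          rw [h4]
          calc 2 * (Real.exp 1 ^ 2 * c) * t' ≤ 2 * (Real.exp 1 ^ 2 * c + 1) *
                (4 * (Real.exp 1 ^ 2 * c + 1))⁻¹ := by gcongr; linarith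
            _ = 1 / 2 := by field_simp; norm_num
        have := nrm_smul_pow_le hN (by positivity) (half_pos ht') (half_lt_self ht')
          (by linarith) hq hB ((X.mono t' t x ht' h1 htS).trans hx) i
          (norm_inv_factorial (𝕜 := 𝕜) i).le
        simpa [Finset.sum_range_succ] using this)
  have e : (fun (J : ℕ) x => (∑ j ∈ Finset.range J, ((j.factorial : 𝕜)⁻¹) • u ^ j) x) =
      fun J x => ∑ j ∈ Finset.range J, ((j.factorial : 𝕜)⁻¹) • (u ^ j) x := by
    funext J x
    simp [LinearMap.sum_apply]
  refine ⟨w, ⟨h1, ?_⟩, fun x => ?_⟩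
  · rw [← e]; exact h2
  · have := h3 x
    simpa [LinearMap.sum_apply] using this

theorem IsPointwiseExp.nrm_sub_le {u w : E →ₗ[𝕜] E} (hw : X.IsPointwiseExp u w) {N B q s t : ℝ}
    (hu : boundedNorm X.nrm X.nrm 1 t u ≤ ENNReal.ofReal N) (hN : 0 ≤ N) (hs : 0 < s) (hst : s < t)
    (hS : t < S) (hq : Real.exp 1 ^ 2 * N / (t - s) ≤ q) (hq2 : q ≤ 1 / 2) (hB : 0 ≤ B) {x : E}
    (hx : X.nrm t x ≤ ENNReal.ofReal B) : X.nrm s (w x - x) ≤ ENNReal.ofReal (2 * q * B) := by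
  have hts : 0 < t - s := by linarith
  have hq0 : 0 ≤ q := le_trans (by positivity) hq
  have h := ((hw x).nrm_sub_le_of_geometric hs (hst.trans hS) hB hq0 hq2
    (by simp [X.nrm_zero hs (hst.trans hS)]) (fun i => by
      have := nrm_smul_pow_le hu hN hs hst hS hq hB hx i (norm_inv_factorial (𝕜 := 𝕜) i).le
      simpa [Finset.sum_range_succ] using this)).2 1
  rw [X.nrm_sub_comm hs (hst.trans hS)] at h
  simp only [Finset.range_one, Finset.sum_singleton, Nat.factorial_zero, Nat.cast_one, inv_one,
    pow_zero, Module.End.one_apply, one_smul, pow_one] at h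
  refine h.trans_eq ?_
  congr 1; ring

/-- The partial sums of the series for `e^u (w + y) - w` when `u w = h - y`. -/
def remainderSum (u : E →ₗ[𝕜] E) (y h : E) (J : ℕ) : E :=
  ∑ i ∈ Finset.range J, (((i.factorial : 𝕜)⁻¹ - ((i + 1).factorial : 𝕜)⁻¹) • (u ^ i) y +
    (((i + 1).factorial : 𝕜)⁻¹) • (u ^ i) h)

/-- Each u^(i+1) w is replaced by u^i h - u^i y. The index shift leaves one unpaired term u^J y /
J!, which tends to zero. -/
theorem sum_exp_eq_remainderSum {u : E →ₗ[𝕜] E} {w y h : E} (huw : u w = h - y) (J : ℕ) :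
    ∑ j ∈ Finset.range (J + 1), ((j.factorial : 𝕜)⁻¹) • (u ^ j) (w + y) - w =
      remainderSum u y h J + ((J.factorial : 𝕜)⁻¹) • (u ^ J) y := by
  induction J with
  | zero => simp [remainderSum]
  | succ J ih =>
    rw [Finset.sum_range_succ, add_sub_right_comm, ih, remainderSum, remainderSum,
      Finset.sum_range_succ]
    have : (u ^ (J + 1)) w = (u ^ J) h - (u ^ J) y := by
      rw [pow_succ, Module.End.mul_apply, huw, map_sub]
    rw [map_add, this]
    module

theorem norm_inv_factorial_sub_le (i : ℕ) :
    ‖((i.factorial : 𝕜)⁻¹ - ((i + 1).factorial : 𝕜)⁻¹)‖ ≤ (i.factorial : ℝ)⁻¹ := by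
  have h : ((i.factorial : 𝕜)⁻¹ - ((i + 1).factorial : 𝕜)⁻¹) =
      (((i.factorial : ℝ)⁻¹ - ((i + 1).factorial : ℝ)⁻¹ : ℝ) : 𝕜) := by push_cast; rfl
  have h1 : ((i + 1).factorial : ℝ)⁻¹ ≤ (i.factorial : ℝ)⁻¹ := by
    gcongr
    exact Nat.le_succ i
  have h2 : (0 : ℝ) ≤ ((i + 1).factorial : ℝ)⁻¹ := by positivity
  rw [h, RCLike.norm_ofReal, abs_of_nonneg (by linarith)]
  linarith

/-- The estimate is used at two indices: i = 0 bounds the whole sum, and i = 1 bounds its distance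
from h, because the coefficient of y at i = 0 vanishes. -/
theorem IsPointwiseExp.remainder {u w : E →ₗ[𝕜] E} (hw : X.IsPointwiseExp u w) {N B C q s t : ℝ}
    (hu : boundedNorm X.nrm X.nrm 1 t u ≤ ENNReal.ofReal N) (hN : 0 ≤ N) (hs : 0 < s) (hst : s < t)
    (hS : t < S) (hq : Real.exp 1 ^ 2 * N / (t - s) ≤ q) (hq2 : q ≤ 1 / 2) (hB : 0 ≤ B) (hC : 0 ≤ C)
    {x y h : E} (hux : u x = h - y) (hy : X.nrm t y ≤ ENNReal.ofReal B)
    (hh : X.nrm t h ≤ ENNReal.ofReal C) :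
    (∀ i, X.nrm s (remainderSum u y h i) < ⊤) ∧
    Tendsto (fun i => X.nrm s (remainderSum u y h i - (w (x + y) - x))) atTop (𝓝 0) ∧
      ∀ i, X.nrm s (remainderSum u y h i - (w (x + y) - x)) ≤
        ENNReal.ofReal (2 * (B + C) * q ^ i) := by
  have hts : 0 < t - s := by linarith
  have hsS := hst.trans hS
  have hq0 : 0 ≤ q := le_trans (by positivity) hq
  have hstep : ∀ i, X.nrm s (remainderSum u y h (i + 1) - remainderSum u y h i) ≤
      ENNReal.ofReal ((B + C) * q ^ i) := by
    intro i
    have e : remainderSum u y h (i + 1) - remainderSum u y h i =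
        ((i.factorial : 𝕜)⁻¹ - ((i + 1).factorial : 𝕜)⁻¹) • (u ^ i) y +
          (((i + 1).factorial : 𝕜)⁻¹) • (u ^ i) h := by
      rw [remainderSum, remainderSum, Finset.sum_range_succ, add_sub_cancel_left]
    rw [e, add_mul]
    refine X.nrm_add_le_ofReal hs hsS (by positivity) (by positivity)
      (nrm_smul_pow_le hu hN hs hst hS hq hB hy i (norm_inv_factorial_sub_le i))
      (nrm_smul_pow_le hu hN hs hst hS hq hC hh i ?_)
    rw [norm_inv_factorial]
    gcongr
    exact Nat.le_succ i
  have h0 : X.nrm s (remainderSum u y h 0) < ⊤ := by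
    simp [remainderSum, X.nrm_zero hs hsS]
  obtain ⟨z, hz, hz'⟩ := exists_limit_of_geometric hs hsS (add_nonneg hB hC) hq0 hq2 h0 hstep
  have hlast : Tendsto (fun J => X.nrm s (((J.factorial : 𝕜)⁻¹) • (u ^ J) y - 0)) atTop (𝓝 0) := by
    have hlim : Tendsto (fun i => ENNReal.ofReal (B * q ^ i)) atTop (𝓝 0) := by
      rw [← ENNReal.ofReal_zero]
      refine ENNReal.tendsto_ofReal ?_
      simpa using (tendsto_pow_atTop_nhds_zero_of_lt_one hq0 (by linarith)).const_mul B
    refine tendsto_of_tendsto_of_tendsto_of_le_of_le tendsto_const_nhds hlim (fun _ => zero_le)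
      fun J => ?_
    rw [sub_zero]
    exact nrm_smul_pow_le hu hN hs hst hS hq hB hy J (norm_inv_factorial J).le
  have h1 : X.Converges (fun J => remainderSum u y h J + ((J.factorial : 𝕜)⁻¹) • (u ^ J) y) z := by
    have := tendsto_nrm_add hs hsS hz hlast
    rw [add_zero] at this
    exact ⟨s, hs, hsS, this⟩
  have h2 := ((hw (x + y)).comp_succ).sub (Converges.of_eq X x)
  simp only [sum_exp_eq_remainderSum hux] at h2
  obtain rfl := h1.unique h2
  refine ⟨fun i => ?_, hz, hz'⟩
  induction i with
  | zero => exact h0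
  | succ i ih =>
    have := (X.nrm_add s (remainderSum u y h (i + 1) - remainderSum u y h i) _ hs hsS).trans_lt
      (ENNReal.add_lt_top.2 ⟨(hstep i).trans_lt ENNReal.ofReal_lt_top, ih⟩)
    rwa [sub_add_cancel] at this

end ScaledSpace

/-! ### Invariance of G and convergence of infinite products -/

namespace ArnoldSpace

variable {𝕜 : Type*} [RCLike 𝕜] {S : ℝ} {E : ℕ∞ → Type*}
  [∀ n, AddCommGroup (E n)] [∀ n, Module 𝕜 (E n)] (X : ArnoldSpace 𝕜 S E)

/-- There is no loss of level, since s = t is allowed for k = 0; the factor e comes from the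
normalisation of N^0. -/
theorem nrm_res_le {i j : ℕ∞} (h : i ≤ j) {s B : ℝ} (hs : 0 < s) (hS : s < S) {x : E i}
    (hx : X.nrm i s x ≤ ENNReal.ofReal B) :
    X.nrm j s (X.res h x) ≤ ENNReal.ofReal (Real.exp 1 * B) := by
  have h1 := X.res_bounded h s hs hS
  have hfin : X.nrm i s x < ⊤ := hx.trans_lt ENNReal.ofReal_lt_top
  by_cases h0 : X.nrm i s x = 0
  · have : x = 0 := (X.scaled i).eq_zero s x hs hS h0
    rw [this, map_zero]
    exact ((X.scaled j).nrm_zero hs hS).trans_le zero_le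
  have h2 : ENNReal.ofReal ((s - s) ^ (0 : ℝ)) * X.nrm j s (X.res h x) /
      (ENNReal.ofReal (Real.exp 1) * X.nrm i s x) ≤ 1 := by
    refine le_trans ?_ h1
    unfold boundedNorm
    exact le_iSup_of_le s (le_iSup_of_le s (le_iSup_of_le x
      (le_iSup_of_le ⟨hs, Or.inr ⟨rfl, rfl⟩, le_rfl, hfin⟩ le_rfl)))
  rw [Real.rpow_zero, ENNReal.ofReal_one, one_mul, ENNReal.div_le_iff
    (by simp [h0, Real.exp_pos]) (ENNReal.mul_ne_top ENNReal.ofReal_ne_top hfin.ne), one_mul] at h2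
  rw [ENNReal.ofReal_mul (Real.exp_pos 1).le]
  refine h2.trans ?_
  gcongr

theorem res_resZero {i j : ℕ∞} (h : i ≤ j) (x : E ((0 : ℕ) : ℕ∞)) :
    X.res h (X.resZero i x) = X.resZero j x :=
  X.res_res _ _ _

theorem resZero_zero (x : E ((0 : ℕ) : ℕ∞)) : X.resZero ((0 : ℕ) : ℕ∞) x = x :=
  X.res_self _ _

/-- The partial sums lie in G and converge at one level, but M is closed only relative to E^(μ). The
limit is first shown to be O(s^μ) by estimating at every small level s from level 2s; closedness of
M, then of G in M, applies. -/
theorem exp_sub_mem {M G : ∀ n, Submodule 𝕜 (E n)} {μ : ℝ}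
    (hM : X.IsClosedSubspace M (X.filtration μ))
    (hG : X.IsClosedSubspace G (fun n => (M n : Set (E n)))) {n : ℕ} {v e : E n →ₗ[𝕜] E n}
    (hv : v ∈ canonicalFiltration (X.endNrm n) 2) (he : (X.scaled n).IsPointwiseExp v e)
    (hvG : ∀ y ∈ G n, v y ∈ G n) {x y : E n} (hvx : v x ∈ G n) (hy : y ∈ G n) :
    e (x + y) - x ∈ G n := by
  set h := v x + y with hh
  have hhG : h ∈ G n := add_mem hvx hy
  have hux : v x = h - y := by rw [hh, add_sub_cancel_right]
  obtain ⟨C, τ, hτ, hC⟩ := hv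
  obtain ⟨C₁, τ₁, hτ₁, hC₁⟩ := hM.subset n (hG.subset n hy) (ENat.natCast_ne_top n)
  obtain ⟨C₂, τ₂, hτ₂, hC₂⟩ := hM.subset n (hG.subset n hhG) (ENat.natCast_ne_top n)
  have hS := (X.scaled n).S_pos
  set c : ℝ := max C 0
  set c₁ : ℝ := max C₁ 0
  set c₂ : ℝ := max C₂ 0
  have hc : 0 ≤ c := le_max_right _ _
  have hc₁ : 0 ≤ c₁ := le_max_right _ _
  have hc₂ : 0 ≤ c₂ := le_max_right _ _
  set σ : ℝ := min (min τ (min τ₁ τ₂)) (min (S / 2) (4 * (Real.exp 1 ^ 2 * c + 1))⁻¹) / 2 with hσ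
  have hσ0 : 0 < σ := by positivity
  have key : ∀ s, 0 < s → s ≤ σ → s < S ∧
      (∀ i, X.nrm n s (ScaledSpace.remainderSum v y h i) < ⊤) ∧
      Tendsto (fun i => X.nrm n s (ScaledSpace.remainderSum v y h i - (e (x + y) - x))) atTop
        (𝓝 0) ∧
      X.nrm n s (e (x + y) - x) ≤ ENNReal.ofReal (2 * (c₁ + c₂) * 2 ^ μ * s ^ μ) := by
    intro s hs hsσ
    have h2s : 2 * s ≤ min (min τ (min τ₁ τ₂)) (min (S / 2) (4 * (Real.exp 1 ^ 2 * c + 1))⁻¹) := by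
      linarith
    have e1 : 2 * s ≤ τ := h2s.trans ((min_le_left _ _).trans (min_le_left _ _))
    have e2 : 2 * s ≤ τ₁ := h2s.trans ((min_le_left _ _).trans
      ((min_le_right _ _).trans (min_le_left _ _)))
    have e3 : 2 * s ≤ τ₂ := h2s.trans ((min_le_left _ _).trans
      ((min_le_right _ _).trans (min_le_right _ _)))
    have e4 : 2 * s ≤ S / 2 := h2s.trans ((min_le_right _ _).trans (min_le_left _ _))
    have e5 : 2 * s ≤ (4 * (Real.exp 1 ^ 2 * c + 1))⁻¹ :=
      h2s.trans ((min_le_right _ _).trans (min_le_right _ _))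
    have hpos : (0 : ℝ) < 2 * s := by positivity
    have hN : boundedNorm (X.nrm n) (X.nrm n) 1 (2 * s) v ≤ ENNReal.ofReal (c * (2 * s) ^ 2) := by
      refine (hC (2 * s) hpos e1).trans (ENNReal.ofReal_le_ofReal ?_)
      rw [Real.rpow_two]
      gcongr
      exact le_max_left _ _
    have hy' : X.nrm n (2 * s) y ≤ ENNReal.ofReal (c₁ * (2 * s) ^ μ) := by
      refine (hC₁ _ hpos e2).trans (ENNReal.ofReal_le_ofReal ?_)
      gcongr
      exact le_max_left _ _
    have hh' : X.nrm n (2 * s) h ≤ ENNReal.ofReal (c₂ * (2 * s) ^ μ) := by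
      refine (hC₂ _ hpos e3).trans (ENNReal.ofReal_le_ofReal ?_)
      gcongr
      exact le_max_left _ _
    have hq : Real.exp 1 ^ 2 * (c * (2 * s) ^ 2) / (2 * s - s) ≤ 1 / 2 := by
      have h4 : Real.exp 1 ^ 2 * (c * (2 * s) ^ 2) / (2 * s - s) =
          2 * (Real.exp 1 ^ 2 * c) * (2 * s) := by
        rw [two_mul s, add_sub_cancel_right]; field_simp; ring
      have h5 : 0 < Real.exp 1 ^ 2 * c + 1 := by positivity
      rw [h4]
      calc 2 * (Real.exp 1 ^ 2 * c) * (2 * s) ≤ 2 * (Real.exp 1 ^ 2 * c + 1) *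
            (4 * (Real.exp 1 ^ 2 * c + 1))⁻¹ := by gcongr; linarith
        _ = 1 / 2 := by field_simp; norm_num
    obtain ⟨f1, f2, f3⟩ := he.remainder hN (by positivity) hs (by linarith) (by linarith) hq le_rfl
      (by positivity) (by positivity) hux hy' hh'
    refine ⟨by linarith, f1, f2, ?_⟩
    have := f3 0
    simp only [ScaledSpace.remainderSum, Finset.range_zero, Finset.sum_empty, zero_sub] at this
    rw [(X.scaled n).nrm_neg hs (by linarith)] at this
    refine this.trans_eq ?_
    rw [Real.mul_rpow zero_le_two hs.le]
    congr 1
    ring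
  have hmem : ∀ i, ScaledSpace.remainderSum v y h i ∈ G n := by
    have hpow : ∀ i, ∀ z ∈ G n, (v ^ i) z ∈ G n := by
      intro i z hz
      induction i with
      | zero => simpa using hz
      | succ i ih => rw [pow_succ', Module.End.mul_apply]; exact hvG _ ih
    intro i
    exact sum_mem fun j _ => add_mem ((G n).smul_mem _ (hpow j _ hy))
      ((G n).smul_mem _ (hpow j _ hhG))
  obtain ⟨g0, g1, g2, -⟩ := key σ hσ0 le_rfl
  have hin : e (x + y) - x ∈ M n :=
    hM.closed n σ hσ0 g0 _ _ (fun i => ⟨hG.subset n (hmem i), g1 i⟩)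
      (fun _ => ⟨_, σ, hσ0, fun s hs hsσ => (key s hs hsσ).2.2.2⟩) g2
  exact hG.closed n σ hσ0 g0 _ _ (fun i => ⟨hmem i, g1 i⟩) hin g2

/-- Of the factor 64^(-n), a part 2^(-n) pays for the shrinking gaps between levels. The remaining
32^(-n) beats the growth 6^n of the partial products, where 6 bounds a factor 2 from e_n times e
from the restriction. -/
theorem exists_infinite_product {u e : ∀ n : ℕ, E n →ₗ[𝕜] E n}
    (he : ∀ n : ℕ, (X.scaled n).IsPointwiseExp (u n) (e n)) {s₀ : ℝ} (hs₀ : 0 < s₀)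
    (hu : ∀ (n : ℕ) (s : ℝ), 0 < s → s ≤ s₀ →
      X.endNrm n s (u n) ≤ ENNReal.ofReal (s ^ 2 * (1 / 64) ^ n)) :
    ∃ g : E ((0 : ℕ) : ℕ∞) →ₗ[𝕜] E ⊤, IsMorphism S (X.nrm ((0 : ℕ) : ℕ∞)) (X.nrm ⊤) g ∧
      ConvergesTo S (X.nrm ((0 : ℕ) : ℕ∞)) (X.nrm ⊤)
        (fun n x => X.res le_top (X.partialProd e n x)) g ∧
      ∀ x, (X.scaled ⊤).Converges (fun n => X.res le_top (X.partialProd e n x)) (g x) := by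
  refine ScaledSpace.exists_limit_morphism (X.scaled _) (X.scaled ⊤)
    (fun n => X.res le_top ∘ₗ X.partialProd e n) fun t ht htS => ?_
  have he3 : Real.exp 1 ≤ 3 := by linarith [Real.exp_one_lt_d9]
  set t' : ℝ := min t (min s₀ (8 * Real.exp 1 ^ 2)⁻¹)
  have ht' : 0 < t' := by positivity
  have h1 : t' ≤ t := min_le_left _ _
  have h2 : t' ≤ s₀ := (min_le_right _ _).trans (min_le_left _ _)
  have h3 : t' ≤ (8 * Real.exp 1 ^ 2)⁻¹ := (min_le_right _ _).trans (min_le_right _ _)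
  -- The levels decrease from t' to t'/2, with gaps t' 2^(-n) / 4.
  set τ : ℕ → ℝ := fun n => t' * (1 / 2 + (1 / 2) ^ (n + 1)) with hτ
  have hτ0 : ∀ n, t' / 2 < τ n := by
    intro n
    have : 0 < t' * (1 / 2 : ℝ) ^ (n + 1) := by positivity
    simp only [hτ]; linarith
  have hτ1 : ∀ n, τ n ≤ t' := by
    intro n
    have : (1 / 2 : ℝ) ^ (n + 1) ≤ 1 / 2 := by
      rw [pow_succ]
      have : (1 / 2 : ℝ) ^ n ≤ 1 := pow_le_one₀ (by norm_num) (by norm_num)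
      linarith
    simp only [hτ]; nlinarith
  have hτd : ∀ n, τ n - τ (n + 1) = t' * (1 / 2) ^ n / 4 := by
    intro n
    simp only [hτ, pow_succ]; ring
  have hpos : ∀ n, 0 < τ n := fun n => (half_pos ht').trans (hτ0 n)
  have hlt : ∀ n, τ (n + 1) < τ n := fun n => by
    have : 0 < t' * (1 / 2 : ℝ) ^ n / 4 := by positivity
    linarith [hτd n]
  have hS : ∀ n, τ n < S := fun n => by linarith [hτ1 n]
  have hstep : ∀ (n : ℕ) (z : E n) (B : ℝ), 0 ≤ B → X.nrm n (τ n) z ≤ ENNReal.ofReal B →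
      X.nrm n (τ (n + 1)) (e n z - z) ≤ ENNReal.ofReal ((1 / 32) ^ n * B) := by
    intro n z B hB hz
    have hN : boundedNorm (X.nrm n) (X.nrm n) 1 (τ n) (u n) ≤
        ENNReal.ofReal (t' ^ 2 * (1 / 64) ^ n) :=
      (boundedNorm_mono (hτ1 n)).trans (hu n t' ht' h2)
    have hp : (1 / 64 : ℝ) ^ n = (1 / 32) ^ n * (1 / 2) ^ n := by rw [← mul_pow]; norm_num
    have hq : Real.exp 1 ^ 2 * (t' ^ 2 * (1 / 64) ^ n) / (τ n - τ (n + 1)) ≤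
        1 / 2 * (1 / 32) ^ n := by
      have h4 : Real.exp 1 ^ 2 * (t' ^ 2 * (1 / 64) ^ n) / (τ n - τ (n + 1)) =
          4 * Real.exp 1 ^ 2 * t' * (1 / 32) ^ n := by
        rw [hτd, hp]; field_simp
      rw [h4]
      calc 4 * Real.exp 1 ^ 2 * t' * (1 / 32) ^ n
          ≤ 4 * Real.exp 1 ^ 2 * (8 * Real.exp 1 ^ 2)⁻¹ * (1 / 32) ^ n := by gcongr
        _ = 1 / 2 * (1 / 32) ^ n := by field_simp; norm_num
    have hle : (1 / 32 : ℝ) ^ n ≤ 1 := pow_le_one₀ (by norm_num) (by norm_num)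
    refine ((he n).nrm_sub_le hN (by positivity) (hpos _) (hlt n) (hS n) hq (by linarith) hB
      hz).trans_eq ?_
    congr 1; ring
  have hexp : ∀ (n : ℕ) (z : E n) (B : ℝ), 0 ≤ B → X.nrm n (τ n) z ≤ ENNReal.ofReal B →
      X.nrm n (τ (n + 1)) (e n z) ≤ ENNReal.ofReal (2 * B) := by
    intro n z B hB hz
    have := (X.scaled n).nrm_add_le_ofReal (hpos (n + 1)) (hS _) (by positivity) hB
      (hstep n z B hB hz) (((X.scaled n).mono _ _ _ (hpos _) (hlt n).le (hS n)).trans hz)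
    rw [sub_add_cancel] at this
    refine this.trans (ENNReal.ofReal_le_ofReal ?_)
    have hle : (1 / 32 : ℝ) ^ n ≤ 1 := pow_le_one₀ (by norm_num) (by norm_num)
    nlinarith
  refine ⟨t' / 2, half_pos ht', by linarith, 6, by norm_num, fun x B hB hx => ?_⟩
  have hP : ∀ n : ℕ, X.nrm n (τ (n + 1)) (X.partialProd e n x) ≤
      ENNReal.ofReal (2 * 6 ^ n * B) := by
    intro n
    induction n with
    | zero =>
      have hx' : X.nrm ((0 : ℕ) : ℕ∞) (τ 0) x ≤ ENNReal.ofReal B :=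
        ((X.scaled _).mono _ _ _ (hpos 0) ((hτ1 0).trans h1) htS).trans hx
      simpa [partialProd] using hexp 0 x B hB hx'
    | succ n ih =>
      have := hexp (n + 1) _ _ (by positivity)
        (X.nrm_res_le (Nat.cast_le.2 (Nat.le_succ n)) (hpos _) (hS _) ih)
      refine this.trans (ENNReal.ofReal_le_ofReal ?_)
      rw [pow_succ]
      have h6 : 0 ≤ (6 : ℝ) ^ n * B := by positivity
      nlinarith
  have hres : ∀ (n : ℕ) (z : E n) (B : ℝ), 0 ≤ B →
      X.nrm n (τ (n + 1)) z ≤ ENNReal.ofReal B →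
      X.nrm ⊤ (t' / 2) (X.res le_top z) ≤ ENNReal.ofReal (3 * B) := by
    intro n z B hB hz
    refine (X.nrm_res_le le_top (half_pos ht') (by linarith)
      (((X.scaled n).mono _ _ _ (half_pos ht') (hτ0 (n + 1)).le (hS _)).trans hz)).trans
      (ENNReal.ofReal_le_ofReal ?_)
    gcongr
  constructor
  · refine (hres 0 _ _ (by positivity) (hP 0)).trans (ENNReal.ofReal_le_ofReal ?_)
    linarith
  · intro n
    have hz := X.nrm_res_le (Nat.cast_le.2 (Nat.le_succ n)) (hpos _) (hS _) (hP n)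
    have h4 := hres (n + 1) _ _ (by positivity) (hstep (n + 1) _ _ (by positivity) hz)
    rw [map_sub, X.res_res] at h4
    refine h4.trans (ENNReal.ofReal_le_ofReal ?_)
    have h7 : (1 / 32 : ℝ) ^ n * 6 ^ n ≤ (1 / 2) ^ n := by
      rw [← mul_pow]
      gcongr
      norm_num
    have h8 : 0 ≤ (1 / 32 : ℝ) ^ n * 6 ^ n := by positivity
    have h9 : Real.exp 1 * ((1 / 32 : ℝ) ^ n * 6 ^ n * B) ≤ 3 * ((1 / 2) ^ n * B) := by gcongr
    calc 3 * ((1 / 32 : ℝ) ^ (n + 1) * (Real.exp 1 * (2 * 6 ^ n * B)))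
        = 6 / 32 * (Real.exp 1 * ((1 / 32 : ℝ) ^ n * 6 ^ n * B)) := by rw [pow_succ]; ring
      _ ≤ 6 / 32 * (3 * ((1 / 2) ^ n * B)) := by gcongr
      _ ≤ 6 * B * (1 / 2) ^ n := by
        have : 0 ≤ (1 / 2 : ℝ) ^ n * B := by positivity
        linarith

end ArnoldSpace

/-! ### Numerical estimates for one step of the iteration -/

/-- The majorant `s^ν (s/T)^o e^{-D}` of the iteration. -/
noncomputable def majorant (ν o D T s : ℝ) : ℝ := s ^ ν * (s / T) ^ o * Real.exp (-D)

theorem majorant_nonneg {ν o D T s : ℝ} (hT : 0 < T) (hs : 0 < s) : 0 ≤ majorant ν o D T s := by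
  unfold majorant; positivity

theorem majorant_le {ν o D T s : ℝ} (hs : 0 < s) (hsT : s ≤ T) (ho : 0 ≤ o) :
    majorant ν o D T s ≤ s ^ ν * Real.exp (-D) := by
  have hT : 0 < T := hs.trans_le hsT
  have : (s / T) ^ o ≤ 1 := Real.rpow_le_one (by positivity) ((div_le_one hT).2 hsT) ho
  unfold majorant
  have h1 : s ^ ν * (s / T) ^ o ≤ s ^ ν * 1 := by gcongr
  rw [mul_one] at h1
  gcongr

/-- The numerical conditions under which one step of the iteration improves the majorant. -/
structure StepCondition (k d ν o D D' T g ω Q K K₀ : ℝ) (n : ℕ) : Prop where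
  k_nonneg : 0 ≤ k
  d_nonneg : 0 ≤ d
  order : 2 * k + 2 ≤ ν
  o_nonneg : 0 ≤ o
  T_pos : 0 < T
  T_le : T ≤ 1
  ω_pos : 0 < ω
  ω_le : ω ≤ 1 / 6
  gap : 6 * ω ≤ g
  Q_one : 1 ≤ Q
  K₀_nonneg : 0 ≤ K₀
  large : 4 * Real.exp 1 ^ 4 * (2 + Real.exp 1 ^ 2 * K₀) * 4 ^ ν ≤ K
  divisor : K * Q * (ω ^ (k + 1 + d))⁻¹ ≤ Real.exp D
  decay : D' ≤ o * g
  degree : 4 * (ν + o) ≤ 2 ^ n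
  harmonic : (k + 1 + d) * -Real.log T ≤ 2 ^ n * g / 4

namespace StepCondition

variable {k d ν o D D' T g ω Q K K₀ : ℝ} {n : ℕ}

theorem K_pos (h : StepCondition k d ν o D D' T g ω Q K K₀ n) : 0 < K := by
  have := h.K₀_nonneg
  exact lt_of_lt_of_le (by positivity) h.large

theorem divisor_le (h : StepCondition k d ν o D D' T g ω Q K K₀ n) :
    Q * (ω ^ (k + 1 + d))⁻¹ * Real.exp (-D) ≤ K⁻¹ := by
  have hK := h.K_pos
  rw [Real.exp_neg, ← div_eq_mul_inv, div_le_iff₀ (Real.exp_pos _), ← div_eq_inv_mul,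
    le_div_iff₀ hK]
  refine le_trans (le_of_eq ?_) h.divisor
  ring

theorem divisor_le' (h : StepCondition k d ν o D D' T g ω Q K K₀ n) :
    Q * (ω ^ (k + 1))⁻¹ * Real.exp (-D) ≤ K⁻¹ := by
  refine le_trans ?_ h.divisor_le
  have h1 := h.Q_one
  have h2 := h.ω_pos
  have : ω ^ (k + 1 + d) ≤ ω ^ (k + 1) :=
    Real.rpow_le_rpow_of_exponent_ge h2 (by linarith [h.ω_le]) (by linarith [h.d_nonneg])
  gcongr

theorem one_add_le_exp (h : StepCondition k d ν o D D' T g ω Q K K₀ n) :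
    1 + 3 * ω ≤ Real.exp (g / 2) := by
  have h1 := Real.add_one_le_exp (3 * ω)
  have h2 : Real.exp (3 * ω) ≤ Real.exp (g / 2) := Real.exp_le_exp.2 (by linarith [h.gap])
  linarith

theorem level_le (h : StepCondition k d ν o D D' T g ω Q K K₀ n) {s : ℝ}
    (hsT : s ≤ T * Real.exp (-g)) : s * (1 + 3 * ω) ≤ T := by
  have h1 := h.one_add_le_exp
  have h2 := h.T_pos
  have h3 := h.ω_pos
  have hg : 0 < g := by linarith [h.gap]
  calc s * (1 + 3 * ω) ≤ T * Real.exp (-g) * Real.exp (g / 2) := by gcongr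
    _ = T * Real.exp (-(g / 2)) := by rw [mul_assoc, ← Real.exp_add]; congr 2; ring
    _ ≤ T * 1 := by gcongr; exact Real.exp_le_one_iff.2 (by linarith)
    _ = T := mul_one T

/-- Raising the level to s(1 + 3ω) costs at most 2^ν e^(og/2), while rewriting s/T through T e^(-g)
gains e^(-og). The net gain is e^(-og/2), and e^(-D) pays for Q and the powers of ω. -/
theorem divided_majorant_le (h : StepCondition k d ν o D D' T g ω Q K K₀ n) {s : ℝ} (hs : 0 < s) :
    Q * majorant ν o D T (s * (1 + 3 * ω)) / (s * ω) ^ (k + 1) ≤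
      2 ^ ν * K⁻¹ * (s ^ (ν - (k + 1)) * (s / (T * Real.exp (-g))) ^ o *
        Real.exp (-(o * g / 2))) := by
  have hT := h.T_pos
  have hω := h.ω_pos
  have hQ := h.Q_one
  have hν : 0 ≤ ν := by linarith [h.order, h.k_nonneg]
  have h1 : (s * (1 + 3 * ω)) ^ ν ≤ 2 ^ ν * s ^ ν := by
    rw [← Real.mul_rpow zero_le_two hs.le]
    refine Real.rpow_le_rpow (by positivity) ?_ hν
    nlinarith [h.ω_le]
  have h2 : (s * (1 + 3 * ω) / T) ^ o ≤
      (s / (T * Real.exp (-g))) ^ o * Real.exp (-(o * g / 2)) := by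
    have e : Real.exp (-(o * g / 2)) = Real.exp (-(g / 2)) ^ o := by
      rw [← Real.exp_mul]; congr 1; ring
    rw [e, ← Real.mul_rpow (by positivity) (by positivity)]
    refine Real.rpow_le_rpow (by positivity) ?_ h.o_nonneg
    have e2 : s / (T * Real.exp (-g)) * Real.exp (-(g / 2)) = s * Real.exp (g / 2) / T := by
      have : Real.exp (-(g / 2)) = Real.exp (g / 2) * Real.exp (-g) := by
        rw [← Real.exp_add]; congr 1; ring
      rw [this]
      field_simp
    rw [e2]
    gcongr
    exact h.one_add_le_exp
  have h3 : (s * ω) ^ (k + 1) = s ^ (k + 1) * ω ^ (k + 1) := Real.mul_rpow hs.le hω.le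
  rw [h3, Real.rpow_sub hs]
  calc Q * majorant ν o D T (s * (1 + 3 * ω)) / (s ^ (k + 1) * ω ^ (k + 1))
      ≤ Q * (2 ^ ν * s ^ ν * ((s / (T * Real.exp (-g))) ^ o * Real.exp (-(o * g / 2))) *
        Real.exp (-D)) / (s ^ (k + 1) * ω ^ (k + 1)) := by
        unfold majorant
        gcongr
    _ = 2 ^ ν * (Q * (ω ^ (k + 1))⁻¹ * Real.exp (-D)) * (s ^ ν / s ^ (k + 1) *
        (s / (T * Real.exp (-g))) ^ o * Real.exp (-(o * g / 2))) := by
        field_simp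
    _ ≤ _ := by
        have := h.divisor_le'
        gcongr

theorem four_rpow (ν : ℝ) : (4 : ℝ) ^ ν = 2 ^ ν * 2 ^ ν := by
  rw [← Real.mul_rpow zero_le_two zero_le_two]; norm_num

theorem exp_one_ge_two : (2 : ℝ) ≤ Real.exp 1 := by
  have := Real.add_one_le_exp (1 : ℝ); linarith

theorem level_le_one (h : StepCondition k d ν o D D' T g ω Q K K₀ n) {s : ℝ}
    (hsT : s ≤ T * Real.exp (-g)) : s ≤ 1 := by
  have hg : 0 < g := by linarith [h.gap, h.ω_pos]
  have := Real.exp_le_one_iff.2 (by linarith : -g ≤ 0)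
  nlinarith [h.T_le, h.T_pos]

theorem smallness (h : StepCondition k d ν o D D' T g ω Q K K₀ n) {s : ℝ} (hs : 0 < s)
    (hsT : s ≤ T * Real.exp (-g)) :
    Real.exp 1 ^ 3 * (Q * majorant ν o D T (s * (1 + 3 * ω)) / (s * ω) ^ (k + 1)) ≤ 1 / 2 := by
  have hT := h.T_pos
  have hK := h.K_pos
  have hg : 0 < g := by linarith [h.gap, h.ω_pos]
  have hν : 0 ≤ ν := by linarith [h.order, h.k_nonneg]
  have h1 : s ^ (ν - (k + 1)) ≤ 1 := Real.rpow_le_one hs.le (h.level_le_one hsT)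
    (by linarith [h.order, h.k_nonneg])
  have h2 : (s / (T * Real.exp (-g))) ^ o ≤ 1 :=
    Real.rpow_le_one (by positivity) ((div_le_one (by positivity)).2 hsT) h.o_nonneg
  have h3 : Real.exp (-(o * g / 2)) ≤ 1 :=
    Real.exp_le_one_iff.2 (by have := mul_nonneg h.o_nonneg hg.le; linarith)
  have h4 := h.divided_majorant_le hs
  have h5 : (1 : ℝ) ≤ 2 ^ ν := Real.one_le_rpow (by norm_num) hν
  have h6 : 2 * Real.exp 1 ^ 3 * 2 ^ ν ≤ K := by
    refine le_trans ?_ h.large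
    rw [four_rpow]
    have := h.K₀_nonneg
    have e2 := exp_one_ge_two
    calc 2 * Real.exp 1 ^ 3 * 2 ^ ν = 2 * (Real.exp 1 ^ 3 * 1) * 1 * (2 ^ ν * 1) := by ring
      _ ≤ 4 * (Real.exp 1 ^ 3 * Real.exp 1) * (2 + Real.exp 1 ^ 2 * K₀) * (2 ^ ν * 2 ^ ν) := by
        have : 0 ≤ Real.exp 1 ^ 2 * K₀ := by positivity
        gcongr <;> linarith
      _ = _ := by ring
  calc Real.exp 1 ^ 3 * (Q * majorant ν o D T (s * (1 + 3 * ω)) / (s * ω) ^ (k + 1))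
      ≤ Real.exp 1 ^ 3 * (2 ^ ν * K⁻¹ * (1 * 1 * 1)) := by
        refine mul_le_mul_of_nonneg_left (h4.trans ?_) (by positivity)
        gcongr
    _ ≤ 1 / 2 := by
        rw [mul_one, mul_one, mul_one, ← mul_assoc, ← div_eq_mul_inv, div_le_iff₀ hK]
        linarith

/-- The square of the divided majorant has order 2(ν - k - 1) ≥ ν in s, exponent 2o in s/T, and
decay e^(-og) ≤ e^(-D'). The constants disappear in K². -/
theorem quadratic (h : StepCondition k d ν o D D' T g ω Q K K₀ n) {s Y : ℝ} (hs : 0 < s)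
    (hsT : s ≤ T * Real.exp (-g))
    (hY : Y = Q * majorant ν o D T (s * (1 + 3 * ω)) / (s * ω) ^ (k + 1)) :
    Real.exp 1 * (2 * (2 * majorant ν o D T (s * (1 + 3 * ω)) + Real.exp 1 ^ 2 * K₀ * Y) *
      (Real.exp 1 ^ 3 * Y)) ≤ 1 / 2 * majorant ν (2 * o) D' (T * Real.exp (-g)) s := by
  have hT := h.T_pos
  have hK := h.K_pos
  have hω := h.ω_pos
  have hQ := h.Q_one
  have hK₀ := h.K₀_nonneg
  have hg : 0 < g := by linarith [h.gap]
  have hν : 0 ≤ ν := by linarith [h.order, h.k_nonneg]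
  have hs1 := h.level_le_one hsT
  have hf0 : 0 ≤ majorant ν o D T (s * (1 + 3 * ω)) := majorant_nonneg hT (by positivity)
  have hsω : (s * ω) ^ (k + 1) ≤ 1 :=
    Real.rpow_le_one (by positivity) (by nlinarith [h.ω_le]) (by linarith [h.k_nonneg])
  have hsω0 : 0 < (s * ω) ^ (k + 1) := by positivity
  have hY0 : 0 ≤ Y := by rw [hY]; positivity
  have hfY : majorant ν o D T (s * (1 + 3 * ω)) ≤ Y := by
    rw [hY, le_div_iff₀ hsω0]
    nlinarith
  set Z := s ^ (ν - (k + 1)) * (s / (T * Real.exp (-g))) ^ o * Real.exp (-(o * g / 2)) with hZ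
  have hYZ : Y ≤ 2 ^ ν * K⁻¹ * Z := hY ▸ h.divided_majorant_le hs
  have hZ0 : 0 ≤ Z := by positivity
  have hZ2 : Z * Z ≤ majorant ν (2 * o) D' (T * Real.exp (-g)) s := by
    have e1 : s ^ (ν - (k + 1)) * s ^ (ν - (k + 1)) ≤ s ^ ν := by
      rw [← Real.rpow_add hs]
      exact Real.rpow_le_rpow_of_exponent_ge hs hs1 (by linarith [h.order])
    have e2 : (s / (T * Real.exp (-g))) ^ o * (s / (T * Real.exp (-g))) ^ o =
        (s / (T * Real.exp (-g))) ^ (2 * o) := by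
      rw [← Real.rpow_add (by positivity)]; congr 1; ring
    have e3 : Real.exp (-(o * g / 2)) * Real.exp (-(o * g / 2)) ≤ Real.exp (-D') := by
      rw [← Real.exp_add]
      exact Real.exp_le_exp.2 (by linarith [h.decay])
    calc Z * Z = (s ^ (ν - (k + 1)) * s ^ (ν - (k + 1))) * ((s / (T * Real.exp (-g))) ^ o *
          (s / (T * Real.exp (-g))) ^ o) * (Real.exp (-(o * g / 2)) * Real.exp (-(o * g / 2))) := by
          rw [hZ]; ring
      _ ≤ s ^ ν * (s / (T * Real.exp (-g))) ^ (2 * o) * Real.exp (-D') := by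
          rw [e2]; gcongr
      _ = _ := rfl
  have hK1 : 4 * Real.exp 1 ^ 4 * (2 + Real.exp 1 ^ 2 * K₀) * 4 ^ ν ≤ K * K := by
    have : 1 ≤ K := by
      refine le_trans ?_ h.large
      have e2 := exp_one_ge_two
      have : (1 : ℝ) ≤ 4 ^ ν := Real.one_le_rpow (by norm_num) hν
      have e4 : (1 : ℝ) ≤ Real.exp 1 ^ 4 := one_le_pow₀ (by linarith)
      calc (1 : ℝ) = 1 * 1 * 1 * 1 := by norm_num
        _ ≤ 4 * Real.exp 1 ^ 4 * (2 + Real.exp 1 ^ 2 * K₀) * 4 ^ ν := by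
          have : 0 ≤ Real.exp 1 ^ 2 * K₀ := by positivity
          gcongr <;> linarith
    exact h.large.trans (le_mul_of_one_le_left hK.le this)
  calc Real.exp 1 * (2 * (2 * majorant ν o D T (s * (1 + 3 * ω)) + Real.exp 1 ^ 2 * K₀ * Y) *
        (Real.exp 1 ^ 3 * Y))
      ≤ Real.exp 1 * (2 * (2 * Y + Real.exp 1 ^ 2 * K₀ * Y) * (Real.exp 1 ^ 3 * Y)) := by gcongr
    _ = 2 * Real.exp 1 ^ 4 * (2 + Real.exp 1 ^ 2 * K₀) * (Y * Y) := by ring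
    _ ≤ 2 * Real.exp 1 ^ 4 * (2 + Real.exp 1 ^ 2 * K₀) *
        ((2 ^ ν * K⁻¹ * Z) * (2 ^ ν * K⁻¹ * Z)) := by gcongr
    _ = 1 / 2 * (4 * Real.exp 1 ^ 4 * (2 + Real.exp 1 ^ 2 * K₀) * 4 ^ ν / (K * K)) * (Z * Z) := by
        rw [four_rpow]; field_simp; ring
    _ ≤ 1 / 2 * 1 * majorant ν (2 * o) D' (T * Real.exp (-g)) s := by
        gcongr
        rw [div_le_one (by positivity)]
        exact hK1
    _ = _ := by ring

theorem exp_le_one_sub (h : StepCondition k d ν o D D' T g ω Q K K₀ n) :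
    Real.exp (-g / 2) ≤ 1 - 2 * ω := by
  have h1 := h.one_add_le_exp
  have hω := h.ω_pos
  rw [neg_div, Real.exp_neg, inv_le_comm₀ (Real.exp_pos _) (by linarith [h.ω_le])]
  refine le_trans ?_ h1
  rw [inv_le_iff_one_le_mul₀ (by linarith [h.ω_le])]
  nlinarith [h.ω_le]

theorem exp_le_one_sub' (h : StepCondition k d ν o D D' T g ω Q K K₀ n) :
    Real.exp (-g) ≤ 1 - 3 * ω := by
  have hω := h.ω_pos
  have h1 : Real.exp (-g) = Real.exp (-g / 2) * Real.exp (-g / 2) := by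
    rw [← Real.exp_add]; congr 1; ring
  have h2 := h.exp_le_one_sub
  have h3 := Real.exp_pos (-g / 2)
  rw [h1]
  nlinarith [h.ω_le]

/-- The power 2^n is spent twice. As a power of σ = s/(T e^(-g)) it provides the order ν + 2o. The
factor e^(-2^n g/2), coming from the distance between T e^(-g) and T(1 - 2ω), pays half for the
negative powers of T and half for e^(-gν - D'). -/
theorem harmonic_tail (h : StepCondition k d ν o D D' T g ω Q K K₀ n) {s : ℝ} (hs : 0 < s)
    (hsT : s ≤ T * Real.exp (-g)) :
    Real.exp 1 * (1 / (T * (1 - 2 * ω) - s) ^ d * (s / (T * (1 - 2 * ω))) ^ (2 ^ n) *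
      (majorant ν o D T T + Real.exp 1 ^ 2 * K₀ *
        (Q * majorant ν o D T T / (T * ω) ^ (k + 1)))) ≤
      1 / 2 * majorant ν (2 * o) D' (T * Real.exp (-g)) s := by
  have hT := h.T_pos
  have hK := h.K_pos
  have hω := h.ω_pos
  have hω6 := h.ω_le
  have hQ := h.Q_one
  have hK₀ := h.K₀_nonneg
  have hg : 0 < g := by linarith [h.gap]
  have hν : 0 ≤ ν := by linarith [h.order, h.k_nonneg]
  have hT' : 0 < T * Real.exp (-g) := by positivity
  set σ := s / (T * Real.exp (-g)) with hσ
  have hσ0 : 0 < σ := by positivity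
  have hσ1 : σ ≤ 1 := (div_le_one hT').2 hsT
  have hgap : T * ω ≤ T * (1 - 2 * ω) - s := by nlinarith [h.exp_le_one_sub']
  have hd : 1 / (T * (1 - 2 * ω) - s) ^ d ≤ 1 / (T * ω) ^ d := by
    gcongr
    exact h.d_nonneg
  have hratio : s / (T * (1 - 2 * ω)) ≤ σ * Real.exp (-g / 2) := by
    have e : σ * Real.exp (-g / 2) = s / (T * Real.exp (-g / 2)) := by
      have : Real.exp (-g) = Real.exp (-g / 2) * Real.exp (-g / 2) := by
        rw [← Real.exp_add]; congr 1; ring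
      rw [hσ, this]; field_simp
    rw [e]
    gcongr
    exact h.exp_le_one_sub
  have hratio0 : 0 ≤ s / (T * (1 - 2 * ω)) :=
    div_nonneg hs.le (mul_nonneg hT.le (by linarith))
  have hpow : (s / (T * (1 - 2 * ω))) ^ (2 ^ n) ≤
      σ ^ (ν + 2 * o) * Real.exp (-(2 ^ n * g / 2)) := by
    calc (s / (T * (1 - 2 * ω))) ^ (2 ^ n) ≤ (σ * Real.exp (-g / 2)) ^ (2 ^ n) := by gcongr
      _ = σ ^ ((2 : ℝ) ^ n) * Real.exp (-(2 ^ n * g / 2)) := by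
        rw [mul_pow, ← Real.exp_nat_mul, ← Real.rpow_natCast]
        push_cast
        congr 2
        ring
      _ ≤ _ := by
        refine mul_le_mul_of_nonneg_right ?_ (Real.exp_pos _).le
        refine Real.rpow_le_rpow_of_exponent_ge hσ0 hσ1 ?_
        linarith [h.degree, h.o_nonneg]
  have hTT : majorant ν o D T T = T ^ ν * Real.exp (-D) := by
    rw [majorant, div_self hT.ne', Real.one_rpow, mul_one]
  have hTω : (T * ω) ^ (k + 1) ≤ 1 :=
    Real.rpow_le_one (by positivity) (by nlinarith [h.T_le]) (by linarith [h.k_nonneg])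
  have hTω0 : 0 < (T * ω) ^ (k + 1) := by positivity
  have hbr : majorant ν o D T T + Real.exp 1 ^ 2 * K₀ *
        (Q * majorant ν o D T T / (T * ω) ^ (k + 1)) ≤
      (1 + Real.exp 1 ^ 2 * K₀) * (Q * (T ^ ν * Real.exp (-D)) / (T * ω) ^ (k + 1)) := by
    rw [hTT, add_mul, one_mul]
    gcongr
    rw [le_div_iff₀ hTω0]
    have : 0 ≤ T ^ ν * Real.exp (-D) := by positivity
    nlinarith
  have hp : (T * ω) ^ (k + 1) * (T * ω) ^ d = T ^ (k + 1 + d) * ω ^ (k + 1 + d) := by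
    rw [← Real.rpow_add (by positivity), Real.mul_rpow hT.le hω.le]
  have hTp : (T ^ (k + 1 + d))⁻¹ = Real.exp ((k + 1 + d) * -Real.log T) := by
    rw [Real.rpow_def_of_pos hT, ← Real.exp_neg]; congr 1; ring
  have hconst : Real.exp 1 * (1 + Real.exp 1 ^ 2 * K₀) * K⁻¹ ≤ 1 / 2 := by
    rw [← div_eq_mul_inv, div_le_iff₀ hK]
    have e2 := exp_one_ge_two
    have e4 : (1 : ℝ) ≤ 4 ^ ν := Real.one_le_rpow (by norm_num) hν
    have e3 : Real.exp 1 ≤ Real.exp 1 ^ 4 := le_self_pow₀ (by linarith) (by norm_num)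
    have h0 : 0 ≤ Real.exp 1 ^ 2 * K₀ := by positivity
    have : Real.exp 1 * (1 + Real.exp 1 ^ 2 * K₀) * 1 ≤
        Real.exp 1 ^ 4 * (2 + Real.exp 1 ^ 2 * K₀) * 4 ^ ν := by
      gcongr; linarith
    linarith [h.large, mul_nonneg (mul_nonneg (pow_nonneg (Real.exp_pos 1).le 4)
      (by linarith : 0 ≤ 2 + Real.exp 1 ^ 2 * K₀)) (by linarith : (0 : ℝ) ≤ 4 ^ ν)]
  have hexp : Real.exp ((k + 1 + d) * -Real.log T) * Real.exp (-(2 ^ n * g / 2)) ≤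
      Real.exp (-g) ^ ν * Real.exp (-D') := by
    rw [← Real.exp_mul, ← Real.exp_add, ← Real.exp_add]
    refine Real.exp_le_exp.2 ?_
    have h1 := h.harmonic
    have h2 := mul_le_mul_of_nonneg_right h.degree hg.le
    have h3 := h.decay
    nlinarith
  have hsν : s ^ ν = σ ^ ν * (T ^ ν * Real.exp (-g) ^ ν) := by
    rw [← Real.mul_rpow hT.le (Real.exp_pos _).le, ← Real.mul_rpow hσ0.le hT'.le, hσ,
      div_mul_cancel₀ _ hT'.ne']
  calc Real.exp 1 * (1 / (T * (1 - 2 * ω) - s) ^ d * (s / (T * (1 - 2 * ω))) ^ (2 ^ n) *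
      (majorant ν o D T T + Real.exp 1 ^ 2 * K₀ *
        (Q * majorant ν o D T T / (T * ω) ^ (k + 1))))
      ≤ Real.exp 1 * (1 / (T * ω) ^ d * (σ ^ (ν + 2 * o) * Real.exp (-(2 ^ n * g / 2))) *
        ((1 + Real.exp 1 ^ 2 * K₀) * (Q * (T ^ ν * Real.exp (-D)) / (T * ω) ^ (k + 1)))) := by
        have : 0 ≤ majorant ν o D T T := majorant_nonneg hT hT
        gcongr
    _ = Real.exp 1 * (1 + Real.exp 1 ^ 2 * K₀) * (Q * Real.exp (-D)) * σ ^ (ν + 2 * o) * T ^ ν *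
        Real.exp (-(2 ^ n * g / 2)) * ((T * ω) ^ (k + 1) * (T * ω) ^ d)⁻¹ := by
        field_simp
    _ = Real.exp 1 * (1 + Real.exp 1 ^ 2 * K₀) *
        (Q * (ω ^ (k + 1 + d))⁻¹ * Real.exp (-D)) * σ ^ (ν + 2 * o) * T ^ ν *
        (Real.exp ((k + 1 + d) * -Real.log T) * Real.exp (-(2 ^ n * g / 2))) := by
        rw [hp, mul_inv, hTp]; ring
    _ ≤ Real.exp 1 * (1 + Real.exp 1 ^ 2 * K₀) * K⁻¹ * σ ^ (ν + 2 * o) * T ^ ν *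
        (Real.exp (-g) ^ ν * Real.exp (-D')) := by
        have := h.divisor_le
        gcongr
    _ ≤ 1 / 2 * σ ^ (ν + 2 * o) * T ^ ν * (Real.exp (-g) ^ ν * Real.exp (-D')) := by gcongr
    _ = 1 / 2 * majorant ν (2 * o) D' (T * Real.exp (-g)) s := by
        rw [majorant, hsν, Real.rpow_add hσ0, ← hσ]; ring

end StepCondition

/-! ### One Newton step -/

namespace ArnoldSpace

variable {𝕜 : Type*} [RCLike 𝕜] {S : ℝ} {E : ℕ∞ → Type*}
  [∀ n, AddCommGroup (E n)] [∀ n, Module 𝕜 (E n)] (X : ArnoldSpace 𝕜 S E)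

theorem endNrm_zero {n : ℕ∞} {s : ℝ} (hS : s < S) : X.endNrm n s 0 = 0 := by
  simp only [endNrm, boundedNorm, ENNReal.iSup_eq_zero]
  rintro σ t x ⟨h1, h2, h3, -⟩
  have hσ : σ ≤ t := by rcases h2 with h | ⟨-, h⟩ <;> linarith
  have : X.nrm n σ ((0 : E n →ₗ[𝕜] E n) x) = 0 := by
    rw [LinearMap.zero_apply]
    exact (X.scaled n).nrm_zero h1 (by linarith)
  rw [this]
  simp

theorem endNrm_apply_le {𝔤 : Submodule 𝕜 (∀ n, E n →ₗ[𝕜] E n)} {G : ∀ n, Submodule 𝕜 (E n)}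
    {n : ℕ∞} {k τ Q B s t : ℝ} {j : G n →ₗ[𝕜] component 𝔤 n}
    (hj : boundedNorm (X.subNrm G n) (X.componentNrm 𝔤 n) k τ j ≤ ENNReal.ofReal Q) (hQ : 0 ≤ Q)
    (hs : 0 < s) (hst : s < t) (ht : t ≤ τ) (hS : τ < S) {y : G n}
    (hy : X.nrm n t y ≤ ENNReal.ofReal B) :
    X.endNrm n s (j y : E n →ₗ[𝕜] E n) ≤ ENNReal.ofReal (Real.exp 1 * Q * B / (t - s) ^ k) := by
  refine nrm_apply_le_of_boundedNorm_le (nF := X.componentNrm 𝔤 n) hj hQ hs hst ht hy fun h0 => ?_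
  have : y = 0 := by
    ext
    exact (X.scaled n).eq_zero t y (hs.trans hst) (by linarith) h0
  rw [this, map_zero]
  exact X.endNrm_zero (by linarith)

/-- The new error is h plus a quadratic remainder, and each takes half of the new majorant. The
division by e anticipates the factor e lost in the restriction to the next index. -/
theorem step_bound {𝔤 : Submodule 𝕜 (∀ n, E n →ₗ[𝕜] E n)} {G : ∀ n, Submodule 𝕜 (E n)}
    {n : ℕ} {k d ν o D D' T g ω Q K K₀ τ : ℝ}
    (hc : StepCondition k d ν o D D' T g ω Q K K₀ n) {j : G n →ₗ[𝕜] component 𝔤 n}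
    (hj : boundedNorm (X.subNrm G n) (X.componentNrm 𝔤 n) k τ j ≤ ENNReal.ofReal Q) (hS : τ < S)
    (hTτ : T ≤ τ) {w : E n} (hw : X.nrm n τ w ≤ ENNReal.ofReal K₀)
    (hjw : ∀ (y : G n) (s t : ℝ), 0 < s → s < t → t ≤ τ → X.nrm n t y < ⊤ →
      (y : E n) - (j y : E n →ₗ[𝕜] E n) w ∈ harmonicLevel (X.nrm n) d n s)
    {y : G n} (hy : ∀ s, 0 < s → s ≤ T → X.nrm n s y ≤ ENNReal.ofReal (majorant ν o D T s))
    {e : E n →ₗ[𝕜] E n} (he : (X.scaled n).IsPointwiseExp (j (-y) : E n →ₗ[𝕜] E n) e)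
    {s : ℝ} (hs : 0 < s) (hsT : s ≤ T * Real.exp (-g)) :
    X.nrm n s (e (w + y) - w) ≤
      ENNReal.ofReal (majorant ν (2 * o) D' (T * Real.exp (-g)) s / Real.exp 1) := by
  have hT := hc.T_pos
  have hω := hc.ω_pos
  have hω6 := hc.ω_le
  have hQ : 0 ≤ Q := by linarith [hc.Q_one]
  have hK₀ := hc.K₀_nonneg
  have he1 := Real.exp_pos 1
  set h : E n := (y : E n) - (j y : E n →ₗ[𝕜] E n) w with hh
  set u : E n →ₗ[𝕜] E n := (j (-y) : E n →ₗ[𝕜] E n) with hu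
  have huw : u w = h - y := by
    rw [hu, hh, map_neg]
    simp
  have hNu : ∀ t t', 0 < t → t < t' → t' ≤ T → X.endNrm n t u ≤
      ENNReal.ofReal (Real.exp 1 * Q * majorant ν o D T t' / (t' - t) ^ k) := by
    intro t t' ht htt' ht'
    refine X.endNrm_apply_le hj hQ ht htt' (ht'.trans hTτ) hS ?_
    rw [Submodule.coe_neg]
    exact ((X.scaled n).nrm_neg (ht.trans htt') (by linarith) _).trans_le
      (hy t' (ht.trans htt') ht')
  -- Three levels are used: y is known at t + 2ε, so j bounds u at t + ε, and applying u to w bounds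
  -- u w, hence h = y + u w, at t.
  have hbound : ∀ t ε, 0 < t → 0 < ε → t + 2 * ε ≤ T →
      X.endNrm n (t + ε) u ≤
        ENNReal.ofReal (Real.exp 1 * Q * majorant ν o D T (t + 2 * ε) / ε ^ k) ∧
      X.nrm n t y ≤ ENNReal.ofReal (majorant ν o D T (t + 2 * ε)) ∧
      X.nrm n t h ≤ ENNReal.ofReal (majorant ν o D T (t + 2 * ε) +
        Real.exp 1 ^ 2 * K₀ * (Q * majorant ν o D T (t + 2 * ε) / ε ^ (k + 1))) := by
    intro t ε ht hε htT
    have hf : 0 ≤ majorant ν o D T (t + 2 * ε) := majorant_nonneg hT (by positivity)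
    have h1 := hNu (t + ε) (t + 2 * ε) (by positivity) (by linarith) htT
    rw [show t + 2 * ε - (t + ε) = ε by ring] at h1
    have h2 : X.nrm n t y ≤ ENNReal.ofReal (majorant ν o D T (t + 2 * ε)) :=
      ((X.scaled n).mono t (t + 2 * ε) _ ht (by linarith) (by linarith)).trans
        (hy _ (by positivity) htT)
    refine ⟨h1, h2, ?_⟩
    have hw' : X.nrm n (t + ε) w ≤ ENNReal.ofReal K₀ :=
      ((X.scaled n).mono _ τ _ (by positivity) (by linarith) hS).trans hw
    have h3 := ScaledSpace.nrm_apply_le (X := X.scaled n) (Y := X.scaled n) (u := u) (k := 1)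
      h1 (by positivity) ht (by linarith) le_rfl (by linarith) hw'
    rw [add_sub_cancel_left, Real.rpow_one, huw] at h3
    have h4 := (X.scaled n).nrm_add_le_ofReal ht (by linarith) hf (by positivity) h2 h3
    rw [add_sub_cancel] at h4
    refine h4.trans_eq ?_
    congr 2
    rw [Real.rpow_add hε, Real.rpow_one]
    field_simp
  have hlevel := hc.level_le hsT
  set f := majorant ν o D T (s * (1 + 3 * ω)) with hf
  have hf0 : 0 ≤ f := majorant_nonneg hT (by positivity)
  set Y := Q * f / (s * ω) ^ (k + 1) with hY
  have hY0 : 0 ≤ Y := by positivity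
  have hsω : 0 < s * ω := by positivity
  have hquad := hc.quadratic hs hsT hY
  have hsmall := hc.smallness hs hsT
  rw [← hf, ← hY] at hsmall
  -- Levels proportional to s: two gaps sω to reach h, and a third one, from s(1 + ω) to s, for the
  -- exponential.
  obtain ⟨b1, b2, b3⟩ := hbound (s * (1 + ω)) (s * ω) (by positivity) hsω (by linarith)
  rw [show s * (1 + ω) + 2 * (s * ω) = s * (1 + 3 * ω) by ring, ← hf] at b1 b2 b3
  rw [← hY] at b3
  have hA : X.nrm n s (h - (e (w + y) - w)) ≤
      ENNReal.ofReal (2 * (2 * f + Real.exp 1 ^ 2 * K₀ * Y) * (Real.exp 1 ^ 3 * Y)) := by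
    have hN : boundedNorm (X.nrm n) (X.nrm n) 1 (s * (1 + ω)) u ≤
        ENNReal.ofReal (Real.exp 1 * Q * f / (s * ω) ^ k) :=
      (boundedNorm_mono (by linarith)).trans b1
    have hq : Real.exp 1 ^ 2 * (Real.exp 1 * Q * f / (s * ω) ^ k) / (s * (1 + ω) - s) ≤
        Real.exp 1 ^ 3 * Y := by
      rw [show s * (1 + ω) - s = s * ω by ring, hY, Real.rpow_add hsω, Real.rpow_one]
      apply le_of_eq
      field_simp
    have := (he.remainder (X := X.scaled n) hN (by positivity) hs (by nlinarith) (by nlinarith)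
      hq hsmall hf0 (by positivity) huw b2 b3).2.2 1
    simp only [ScaledSpace.remainderSum, Finset.range_one, Finset.sum_singleton,
      Nat.factorial_zero, zero_add, Nat.factorial_one, Nat.cast_one, inv_one, sub_self,
      zero_smul, pow_zero, Module.End.one_apply, one_smul, pow_one] at this
    refine this.trans_eq ?_
    congr 1
    ring
  have hharm := hc.harmonic_tail hs hsT
  -- For the harmonic estimate h is bounded at a level near T, independent of s, so that the full
  -- power (s/t)^(2^n) is available.
  obtain ⟨-, -, c3⟩ := hbound (T * (1 - 2 * ω)) (T * ω) (mul_pos hT (by linarith)) (by positivity)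
    (by linarith)
  rw [show T * (1 - 2 * ω) + 2 * (T * ω) = T by ring] at c3
  have hsz : s < T * (1 - 2 * ω) := by
    have h1 := hc.exp_le_one_sub'
    have h2 := mul_pos hT hω
    nlinarith
  have hB : X.nrm n s h ≤ ENNReal.ofReal (1 / (T * (1 - 2 * ω) - s) ^ d *
      (s / (T * (1 - 2 * ω))) ^ (2 ^ n) * (majorant ν o D T T + Real.exp 1 ^ 2 * K₀ *
        (Q * majorant ν o D T T / (T * ω) ^ (k + 1)))) := by
    have h1 := (hjw y (T * (1 - 2 * ω)) T (by nlinarith) (by nlinarith [mul_pos hT hω]) hTτ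
      ((hy T hT le_rfl).trans_lt ENNReal.ofReal_lt_top)).2 s hs hsz
    have hz1 : 0 < T * (1 - 2 * ω) - s := by linarith
    have hz2 : 0 < T * (1 - 2 * ω) := by linarith
    refine h1.trans ((mul_le_mul' le_rfl c3).trans_eq (ENNReal.ofReal_mul ?_).symm)
    positivity
  have hTT : 0 ≤ majorant ν o D T T := majorant_nonneg hT hT
  have hz1 : 0 < T * (1 - 2 * ω) - s := by linarith
  have hz2 : 0 < T * (1 - 2 * ω) := by linarith
  have hfin := (X.scaled n).nrm_sub_le_ofReal hs (by linarith) (by positivity) (by positivity) hB hA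
  rw [sub_sub_cancel] at hfin
  refine hfin.trans (ENNReal.ofReal_le_ofReal ?_)
  rw [le_div_iff₀ he1]
  linarith

end ArnoldSpace

/-! ### Choice of the parameters -/

/-- The exponents by which the iteration outweighs the divisors `q_n`. -/
noncomputable def decayExponent (p δ A K : ℝ) (q : ℕ → ℝ) (n : ℕ) : ℝ :=
  Real.log K + Real.log (max 1 (q n)) + p * (n * Real.log 2 + Real.log 6) + n * Real.log 64 +
    A ^ n + δ

theorem summable_decayExponent {p δ A K : ℝ} {q : ℕ → ℝ} (hA1 : 1 < A) (hA2 : A < 2)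
    (hq : Summable fun n => Real.log (max 1 (q n)) / 2 ^ n) :
    Summable fun n => decayExponent p δ A K q n / 2 ^ n := by
  have h1 : Summable fun n : ℕ => (1 / 2 : ℝ) ^ n := summable_geometric_two
  have h2 : Summable fun n : ℕ => (n : ℝ) * (1 / 2 : ℝ) ^ n := by
    simpa using summable_pow_mul_geometric_of_norm_lt_one (R := ℝ) 1 (r := (1 / 2 : ℝ))
      (by norm_num)
  have h3 : Summable fun n : ℕ => (A / 2) ^ n :=
    summable_geometric_of_lt_one (by linarith) (by linarith)
  refine ((((h1.mul_left (Real.log K + p * Real.log 6 + δ)).add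
    (h2.mul_left (p * Real.log 2 + Real.log 64))).add h3).add hq).congr fun n => ?_
  rw [decayExponent, div_pow, div_pow, one_pow]
  field_simp
  ring

/-- The bound 1 comes from A^n and serves the harmonic condition; δ makes the gaps g_i large enough
against ω_i; n log 64 forces the errors to tend to zero. -/
theorem le_decayExponent {p δ A K : ℝ} {q : ℕ → ℝ} (hp : 0 ≤ p) (hδ : 0 ≤ δ) (hA1 : 1 < A)
    (hK : 1 ≤ K) (n : ℕ) : 1 ≤ decayExponent p δ A K q n ∧ δ ≤ decayExponent p δ A K q n ∧
      n * Real.log 64 ≤ decayExponent p δ A K q n := by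
  have h1 := Real.log_nonneg hK
  have h2 := Real.log_nonneg (le_max_left 1 (q n))
  have h3 : 0 ≤ p * (n * Real.log 2 + Real.log 6) := by
    have := Real.log_nonneg (by norm_num : (1 : ℝ) ≤ 2)
    have := Real.log_nonneg (by norm_num : (1 : ℝ) ≤ 6)
    positivity
  have h4 : 0 ≤ n * Real.log 64 := by
    have := Real.log_nonneg (by norm_num : (1 : ℝ) ≤ 64)
    positivity
  have h5 : 1 ≤ A ^ n := one_le_pow₀ hA1.le
  unfold decayExponent
  refine ⟨?_, ?_, ?_⟩ <;> linarith

theorem exp_decayExponent {p δ A K : ℝ} {q : ℕ → ℝ} (hK : 0 < K) (n : ℕ) :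
    Real.exp (decayExponent p δ A K q n) = K * max 1 (q n) * ((1 / (6 * 2 ^ n)) ^ p)⁻¹ * 64 ^ n *
      Real.exp (A ^ n) * Real.exp δ := by
  have hm : 0 < max 1 (q n) := lt_of_lt_of_le one_pos (le_max_left _ _)
  have h1 : ((1 / (6 * 2 ^ n) : ℝ) ^ p)⁻¹ = Real.exp (p * (n * Real.log 2 + Real.log 6)) := by
    rw [one_div, Real.inv_rpow (by positivity), inv_inv, Real.rpow_def_of_pos (by positivity),
      Real.log_mul (by norm_num) (by positivity), Real.log_pow]
    congr 1; ring
  have h2 : (64 : ℝ) ^ n = Real.exp (n * Real.log 64) := by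
    rw [Real.exp_nat_mul, Real.exp_log (by norm_num)]
  rw [decayExponent, Real.exp_add, Real.exp_add, Real.exp_add, Real.exp_add, Real.exp_add,
    Real.exp_log hK, Real.exp_log hm, h1, h2]

/-- The choice of the parameters of the iteration, started at a sufficiently large index `N`. -/
theorem exists_stepCondition {k d ν δ K₀ A c c' τ : ℝ} {q : ℕ → ℝ} (hk : 0 ≤ k) (hd : 0 ≤ d)
    (hν : 2 * k + 2 ≤ ν) (hδ : 0 < δ) (hK₀ : 0 ≤ K₀) (hA1 : 1 < A) (hA2 : A < 2) (hτ : 0 < τ)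
    (hc' : 0 ≤ c') (hq : Summable fun n => Real.log (max 1 (q n)) / 2 ^ n) :
    ∃ (N : ℕ) (K T' : ℝ) (T g D ω : ℕ → ℝ), 0 < T' ∧ (∀ i, T' ≤ T i) ∧ (∀ i, T i ≤ τ) ∧
      (∀ i, T (i + 1) = T i * Real.exp (-g i)) ∧ c * T 0 ^ δ ≤ Real.exp (-D 0) ∧
      (∀ i : ℕ, i * Real.log 64 ≤ D i) ∧
      (∀ i, c' * max 1 (q (N + i)) * 64 ^ (N + i) * Real.exp (A ^ (N + i)) ≤ Real.exp (D i)) ∧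
      ∀ i, StepCondition k d ν (2 ^ i * δ) (D i) (D (i + 1)) (T i) (g i) (ω i)
        (max 1 (q (N + i))) K K₀ (N + i) := by
  set p := k + 1 + d with hp
  have hp0 : 0 < p := by positivity
  set K := 4 * Real.exp 1 ^ 4 * (2 + Real.exp 1 ^ 2 * K₀) * 4 ^ ν + 1 + c' with hK
  have hKpos : 0 ≤ 4 * Real.exp 1 ^ 4 * (2 + Real.exp 1 ^ 2 * K₀) * 4 ^ ν := by positivity
  have hK1 : 1 ≤ K := by linarith
  set W := decayExponent p δ A K q with hW
  have hW1 := fun n => le_decayExponent (q := q) hp0.le hδ.le hA1 hK1 n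
  have hsum : Summable fun n => W n / 2 ^ n := summable_decayExponent hA1 hA2 hq
  set R : ℕ → ℝ := fun N => ∑' j, W (j + N) / 2 ^ (j + N) with hR
  have hRlim : Tendsto R atTop (𝓝 0) := tendsto_sum_nat_add fun n => W n / 2 ^ n
  set c₀ := |Real.log τ| + |Real.log (max 1 c)| / δ with hc₀
  have hc₀0 : 0 ≤ c₀ := by positivity
  -- Every contribution to -log T_i is o(2^N): the constant c₀, the starting cost W_N / δ, and the
  -- sum of the g_i, which is a tail of a convergent series times 2^N.
  have hlim : Tendsto (fun N : ℕ => p * (c₀ * (1 / 2) ^ N + W N / 2 ^ N / δ + 2 * R (N + 1) / δ))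
      atTop (𝓝 0) := by
    have h1 : Tendsto (fun N : ℕ => c₀ * (1 / 2 : ℝ) ^ N) atTop (𝓝 0) := by
      simpa using (tendsto_pow_atTop_nhds_zero_of_lt_one (r := (1 / 2 : ℝ)) (by norm_num)
        (by norm_num)).const_mul c₀
    have h2 : Tendsto (fun N : ℕ => W N / 2 ^ N / δ) atTop (𝓝 0) := by
      simpa using hsum.tendsto_atTop_zero.div_const δ
    have h3 : Tendsto (fun N : ℕ => 2 * R (N + 1) / δ) atTop (𝓝 0) := by
      simpa using ((hRlim.comp (tendsto_add_atTop_nat 1)).const_mul 2).div_const δ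
    simpa using ((h1.add h2).add h3).const_mul p
  have hev1 := hlim.eventually (gt_mem_nhds (by positivity : 0 < 1 / (4 * δ)))
  have hev2 := (tendsto_pow_atTop_atTop_of_one_lt (r := (2 : ℝ)) one_lt_two).eventually
    (eventually_ge_atTop (4 * (ν + δ)))
  obtain ⟨N, hN1, hN2⟩ := (hev1.and hev2).exists
  -- With D_i = W(N + i) this is the solution of 2^i δ g_i = D_(i+1), so the decay condition holds
  -- with equality.
  set g : ℕ → ℝ := fun i => W (N + i + 1) / (2 ^ i * δ) with hg
  have hg0 : ∀ i, 0 < g i := fun i => by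
    have := (hW1 (N + i + 1)).1
    have : 0 < W (N + i + 1) := by linarith
    positivity
  -- The values -log T_i. In c₀ the first term gives T_i ≤ τ and the second absorbs c; W_N / δ turns
  -- T_0^δ into e^(-D_0).
  set x : ℕ → ℝ := fun i => c₀ + W N / δ + ∑ j ∈ Finset.range i, g j with hx
  set X := 2 ^ N * (c₀ * (1 / 2) ^ N + W N / 2 ^ N / δ + 2 * R (N + 1) / δ) with hX
  have hx0 : ∀ i, c₀ + W N / δ ≤ x i := fun i =>
    le_add_of_nonneg_right (Finset.sum_nonneg fun j _ => (hg0 j).le)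
  have hWδ : 0 ≤ W N / δ := div_nonneg (by linarith [(hW1 N).1]) hδ.le
  have hxX : ∀ i, x i ≤ X := by
    intro i
    have h1 : ∑ j ∈ Finset.range i, g j =
        2 ^ N * 2 / δ * ∑ j ∈ Finset.range i, W (j + (N + 1)) / 2 ^ (j + (N + 1)) := by
      rw [Finset.mul_sum]
      refine Finset.sum_congr rfl fun j _ => ?_
      simp only [hg]
      rw [show N + j + 1 = j + (N + 1) by ring, pow_add, pow_succ]
      field_simp
    have h2 : ∑ j ∈ Finset.range i, W (j + (N + 1)) / 2 ^ (j + (N + 1)) ≤ R (N + 1) :=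
      ((summable_nat_add_iff (N + 1)).2 hsum).sum_le_tsum _ fun j _ =>
        div_nonneg (by linarith [(hW1 (j + (N + 1))).1]) (by positivity)
    have h3 : X = c₀ + W N / δ + 2 ^ N * 2 / δ * R (N + 1) := by
      rw [hX, div_pow, one_pow]
      field_simp
    rw [h3, hx]
    simp only
    rw [h1]
    gcongr
  have hpX : p * X ≤ 2 ^ N / (4 * δ) := by
    calc p * X = 2 ^ N * (p * (c₀ * (1 / 2) ^ N + W N / 2 ^ N / δ + 2 * R (N + 1) / δ)) := by
          rw [hX]; ring
      _ ≤ 2 ^ N * (1 / (4 * δ)) := by gcongr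
      _ = 2 ^ N / (4 * δ) := by ring
  refine ⟨N, K, Real.exp (-X), fun i => Real.exp (-x i), g, fun i => W (N + i),
    fun i => 1 / (6 * 2 ^ (N + i)), Real.exp_pos _, fun i => Real.exp_le_exp.2 (by linarith [hxX i]),
    fun i => ?_, fun i => ?_, ?_, fun i => ?_, fun i => ?_, fun i => ?_⟩
  · rw [← Real.le_log_iff_exp_le hτ]
    have h1 := neg_abs_le (Real.log τ)
    have h2 : 0 ≤ |Real.log (max 1 c)| / δ := by positivity
    linarith [hx0 i]
  · rw [← Real.exp_add]
    simp only [hx, Finset.sum_range_succ]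
    congr 1; ring
  · have hm : 0 < max 1 c := lt_of_lt_of_le one_pos (le_max_left _ _)
    have h1 : c ≤ Real.exp |Real.log (max 1 c)| :=
      (le_max_right 1 c).trans (by
        rw [← Real.log_le_iff_le_exp hm]; exact le_abs_self _)
    rw [← Real.exp_mul]
    calc c * Real.exp (-x 0 * δ) ≤ Real.exp |Real.log (max 1 c)| * Real.exp (-x 0 * δ) := by gcongr
      _ ≤ Real.exp (-W (N + 0)) := by
        rw [← Real.exp_add]
        refine Real.exp_le_exp.2 ?_
        have h2 : x 0 * δ = |Real.log τ| * δ + |Real.log (max 1 c)| + W N := by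
          simp only [hx, Finset.range_zero, Finset.sum_empty, hc₀]
          field_simp
          ring
        have h3 : 0 ≤ |Real.log τ| * δ := by positivity
        rw [add_zero]
        linarith
  · refine le_trans ?_ (hW1 (N + i)).2.2
    have := Real.log_nonneg (by norm_num : (1 : ℝ) ≤ 64)
    gcongr
    omega
  · rw [hW, exp_decayExponent (by linarith)]
    have h1 : 0 < max 1 (q (N + i)) := lt_of_lt_of_le one_pos (le_max_left _ _)
    have h2 : 1 ≤ ((1 / (6 * 2 ^ (N + i)) : ℝ) ^ p)⁻¹ := by
      refine (one_le_inv₀ (by positivity)).2 (Real.rpow_le_one (by positivity) ?_ hp0.le)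
      rw [div_le_one (by positivity)]
      have : (1 : ℝ) ≤ 2 ^ (N + i) := one_le_pow₀ (by norm_num)
      linarith
    have h3 : 1 ≤ Real.exp δ := Real.one_le_exp hδ.le
    calc c' * max 1 (q (N + i)) * 64 ^ (N + i) * Real.exp (A ^ (N + i))
        = c' * max 1 (q (N + i)) * 1 * 64 ^ (N + i) * Real.exp (A ^ (N + i)) * 1 := by ring
      _ ≤ _ := by
        gcongr
        linarith
  · have hpow : (1 : ℝ) ≤ 2 ^ (N + i) := one_le_pow₀ (by norm_num)
    have hpow2 : (1 : ℝ) ≤ 2 ^ i := one_le_pow₀ (by norm_num)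
    refine ⟨hk, hd, hν, by positivity, Real.exp_pos _, ?_, by positivity, ?_, ?_,
      le_max_left _ _, hK₀, by linarith, ?_, ?_, ?_, ?_⟩
    · exact Real.exp_le_one_iff.2 (by linarith [hx0 i])
    · rw [div_le_div_iff₀ (by positivity) (by norm_num)]
      linarith
    · simp only [hg]
      rw [le_div_iff₀ (by positivity)]
      refine le_trans ?_ (hW1 (N + i + 1)).2.1
      have : (1 : ℝ) ≤ 2 ^ N := one_le_pow₀ (by norm_num)
      calc 6 * (1 / (6 * 2 ^ (N + i))) * (2 ^ i * δ) = δ / 2 ^ N := by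
            rw [pow_add]; field_simp
        _ ≤ δ := div_le_self hδ.le this
    · rw [hW, exp_decayExponent (by linarith)]
      have h1 : 0 < max 1 (q (N + i)) := lt_of_lt_of_le one_pos (le_max_left _ _)
      have h2 : (1 : ℝ) ≤ 64 ^ (N + i) := one_le_pow₀ (by norm_num)
      have h3 : 1 ≤ Real.exp δ := Real.one_le_exp hδ.le
      have h4 : 1 ≤ Real.exp (A ^ (N + i)) := Real.one_le_exp (by positivity)
      rw [mul_assoc (K * max 1 (q (N + i)) * _), mul_assoc (K * max 1 (q (N + i)) * _)]
      refine le_mul_of_one_le_right (by positivity) ?_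
      exact one_le_mul_of_one_le_of_one_le (one_le_mul_of_one_le_of_one_le h2 h4) h3
    · apply le_of_eq
      simp only [hg]
      rw [← add_assoc]
      field_simp
    · have : 4 * (ν + δ) * 2 ^ i ≤ 2 ^ N * 2 ^ i := by gcongr
      rw [pow_add]
      have hν0 : 0 ≤ ν := by linarith
      nlinarith
    · rw [Real.log_exp, neg_neg]
      calc p * x i ≤ p * X := by gcongr; exact hxX i
        _ ≤ 2 ^ N / (4 * δ) := hpX
        _ = 2 ^ N * 1 / (4 * δ) := by ring
        _ ≤ 2 ^ N * W (N + i + 1) / (4 * δ) := by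
          gcongr
          exact (hW1 (N + i + 1)).1
        _ = 2 ^ (N + i) * g i / 4 := by
          simp only [hg]
          rw [pow_add]; field_simp

theorem isTamedSeq_one : IsTamedSeq fun _ => 1 :=
  ⟨monotone_const, fun _ => one_pos, by simp⟩

/-- The surplus order δ is what buys the initial smallness: s^δ = (s/T)^δ T^δ, and T^δ is small. -/
theorem le_majorant_of_start {ν δ D T c s : ℝ} (hT : 0 < T) (hs : 0 < s)
    (h : c * T ^ δ ≤ Real.exp (-D)) : c * s ^ (ν + δ) ≤ majorant ν δ D T s := by
  have hT' : 0 < T ^ δ := Real.rpow_pos_of_pos hT _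
  rw [majorant, Real.rpow_add hs, Real.div_rpow hs.le hT.le]
  calc c * (s ^ ν * s ^ δ) = s ^ ν * (s ^ δ / T ^ δ) * (c * T ^ δ) := by field_simp
    _ ≤ _ := by gcongr

/-! ### The iteration and the proof of the theorem -/

namespace ArnoldSpace

variable {𝕜 : Type*} [RCLike 𝕜] {S : ℝ} {E : ℕ∞ → Type*}
  [∀ n, AddCommGroup (E n)] [∀ n, Module 𝕜 (E n)] (X : ArnoldSpace 𝕜 S E)

theorem exp_zero_apply {n : ℕ∞} {e : E n →ₗ[𝕜] E n} (he : (X.scaled n).IsPointwiseExp 0 e)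
    (x : E n) : e x = x := by
  obtain ⟨t, ht, htS, hx⟩ := (X.scaled n).exhaust x
  have h0 : X.endNrm n t 0 ≤ ENNReal.ofReal 0 := (X.endNrm_zero htS).trans_le zero_le
  have h := he.nrm_sub_le h0 le_rfl (half_pos ht) (half_lt_self ht) htS (q := 0) (by simp)
    (by norm_num) ENNReal.toReal_nonneg (ENNReal.ofReal_toReal hx.ne).ge
  rw [← sub_eq_zero]
  refine (X.scaled n).eq_zero (t / 2) _ (half_pos ht) (by linarith) ?_
  simpa using h

theorem isBoundedElement_resZero {F : ∀ n, Submodule 𝕜 (E n)} {β : E ((0 : ℕ) : ℕ∞)}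
    (hβ : ∀ n, X.resZero n β ∈ F n) : X.IsBoundedElement F fun n => ⟨X.resZero n β, hβ n⟩ := by
  obtain ⟨t, ht, htS, hx⟩ := (X.scaled _).exhaust β
  exact ⟨t, ht, htS, _, fun n => X.nrm_res_le _ ht htS (ENNReal.ofReal_toReal hx.ne).ge⟩

/-- The errors y_n are recorded relative to the compatible family w_n, which restriction to the next
index restores. -/
theorem partialProd_apply_add {w : ∀ n : ℕ, E n} {y : ∀ n : ℕ, E n}
    {e : ∀ n : ℕ, E n →ₗ[𝕜] E n}
    (hw : ∀ n : ℕ, X.res (Nat.cast_le.2 (Nat.le_succ n)) (w n) = w (n + 1))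
    (hy : ∀ n : ℕ, y (n + 1) =
      X.res (Nat.cast_le.2 (Nat.le_succ n)) (e n (w n + y n) - w n)) (n : ℕ) :
    X.partialProd e n (w 0 + y 0) = e n (w n + y n) := by
  induction n with
  | zero => rfl
  | succ n ih =>
    have : X.partialProd e (n + 1) (w 0 + y 0) = e (n + 1)
        (X.res (Nat.cast_le.2 (Nat.le_succ n)) (X.partialProd e n (w 0 + y 0))) := rfl
    rw [this, ih, hy n, map_sub, hw n, add_sub_cancel]

end ArnoldSpace

theorem theoremT {𝕜 : Type*} [RCLike 𝕜] {S : ℝ} {E : ℕ∞ → Type*}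
    [∀ n, AddCommGroup (E n)] [∀ n, Module 𝕜 (E n)] (X : ArnoldSpace 𝕜 S E)
    (μ m k l : ℝ) (hμ : 0 ≤ μ) (hm : 0 ≤ m) (hk : 0 ≤ k) (hl : 0 ≤ l)
    (M F G : ∀ n, Submodule 𝕜 (E n))
    (hM : X.IsClosedSubspace M (X.filtration μ))
    (hFG : X.IsBoundedSplitting M F G m)
    -- the space `𝔤_• ⊂ 𝓜^1(E_•)^{(2)}`
    (𝔤 : Submodule 𝕜 (∀ n, E n →ₗ[𝕜] E n))
    (h𝔤_tame : ∀ u ∈ 𝔤, IsTamedMorphism S X.nrm X.nrm 1 (fun n => (u n : E n → E n)))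
    (h𝔤_two : ∀ u ∈ 𝔤, ∀ n : ℕ, u n ∈ canonicalFiltration (X.endNrm n) 2)
    (h𝔤_G : ∀ u ∈ 𝔤, ∀ n, ∀ y ∈ G n, u n y ∈ G n)
    (a : E ((0 : ℕ) : ℕ∞))
    (h𝔤_a : ∀ u ∈ 𝔤, ∀ n, u n (X.resZero n a) ∈ G n)
    -- the maps `ρ(α) : 𝔤_• → G_•`, `u ↦ u (a + α)` are well defined
    (hρ : ∀ n (α : F n), ∀ u ∈ ArnoldSpace.component 𝔤 n, u (X.resZero n a + (α : E n)) ∈ G n)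
    (r : ℕ → ℝ)
    (j : ∀ n, F n → (G n →ₗ[𝕜] ArnoldSpace.component 𝔤 n))
    -- A) `j(α)` is a `k`-tamed right quasi-inverse of `ρ(α)`
    (hjA : ∀ α : ∀ n, F n, X.IsBoundedElement F α →
      IsTamedMorphism S (X.subNrm G) (X.componentNrm 𝔤) k (fun n => j n (α n)) ∧
      ∃ d : ℝ, 0 ≤ d ∧ IsRightQuasiInverse S (X.subNrm G) d
        (fun n => ArnoldSpace.evalMap 𝔤 G n (X.resZero n a + (α n : E n)) (hρ n (α n)))
        (fun n => j n (α n)))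
    -- B) `α ↦ j(α)` is `l`-tamed
    (hjB : IsTamedMap S (X.subNrm F)
      (fun n s (v : G n →ₗ[𝕜] ArnoldSpace.component 𝔤 n) =>
        boundedNorm (X.subNrm G n) (X.componentNrm 𝔤 n) k s v) r l j)
    -- C)
    (hμ' : 2 * k + l + m + 2 < μ)
    (b : E ((0 : ℕ) : ℕ∞)) (hb : b ∈ M ((0 : ℕ) : ℕ∞)) (A : ℝ) (hA1 : 1 < A) (hA2 : A < 2) :
    ∃ u : ∀ n, E n →ₗ[𝕜] E n,
      IsTamedMorphism S X.nrm X.nrm 1 (fun n => (u n : E n → E n)) ∧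
      (∀ n, u n ∈ ArnoldSpace.component 𝔤 n) ∧
      (∃ s₀ : ℝ, 0 < s₀ ∧ ∀ s, 0 < s → s ≤ s₀ → ∀ n : ℕ,
        X.endNrm n s (u n) < ENNReal.ofReal (s ^ (k + l + m + 2) * Real.exp (-A ^ n))) ∧
      ∃ (e : ∀ n : ℕ, E n →ₗ[𝕜] E n) (g : E ((0 : ℕ) : ℕ∞) →ₗ[𝕜] E ⊤),
        (∀ n : ℕ, IsExp S (X.nrm n) (u n) (e n)) ∧
        IsMorphism S (X.nrm ((0 : ℕ) : ℕ∞)) (X.nrm ⊤) g ∧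
        ConvergesTo S (X.nrm ((0 : ℕ) : ℕ∞)) (X.nrm ⊤)
          (fun n x => X.res le_top (X.partialProd e n x)) g ∧
        g (a + b) - X.resZero ⊤ a ∈ F ⊤ := by
  obtain ⟨πF, πG, hπ, -⟩ := hFG.projections
  set β : E ((0 : ℕ) : ℕ∞) := (πF ((0 : ℕ) : ℕ∞) ⟨b, hb⟩).1
  set γ₀ : G ((0 : ℕ) : ℕ∞) := πG ((0 : ℕ) : ℕ∞) ⟨b, hb⟩
  have hb' : b = β + γ₀ := hπ _ ⟨b, hb⟩
  have hβF : ∀ n, X.resZero n β ∈ F n := fun n => hFG.closed_left.res_mem _ _ (πF _ _).2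
  set α : ∀ n, F n := fun n => ⟨X.resZero n β, hβF n⟩
  set w : ∀ n, E n := fun n => X.resZero n a + α n with hw
  have hwres : ∀ n, w n = X.resZero n (a + β) := fun n => (map_add _ _ _).symm
  -- The argument α is fixed once and for all, so the bounds and the exponent d of the quasi-inverse
  -- are those of a single family j(α).
  obtain ⟨⟨τ₁, hτ₁, hτ₁S, ⟨p, hp, hjp⟩, -⟩, d, hd, τ₂, hτ₂, hτ₂S, hquasi⟩ :=
    hjA α (X.isBoundedElement_resZero hβF)
  obtain ⟨C, τ₃, hτ₃, hC⟩ := hM.subset _ (hFG.closed_right.subset _ γ₀.2) (ENat.natCast_ne_top 0)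
  obtain ⟨τ₄, hτ₄, hτ₄S, hK₀⟩ := (X.scaled _).exhaust (a + β)
  set τ := min (min τ₁ τ₂) (min τ₃ τ₄)
  have hτ : 0 < τ := by positivity
  have hττ₁ : τ ≤ τ₁ := (min_le_left _ _).trans (min_le_left _ _)
  have hττ₂ : τ ≤ τ₂ := (min_le_left _ _).trans (min_le_right _ _)
  have hττ₃ : τ ≤ τ₃ := (min_le_right _ _).trans (min_le_left _ _)
  have hττ₄ : τ ≤ τ₄ := (min_le_right _ _).trans (min_le_right _ _)
  have hτS : τ < S := hττ₁.trans_lt hτ₁S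
  set K₀ := Real.exp 1 * (X.nrm ((0 : ℕ) : ℕ∞) τ₄ (a + β)).toReal
  have hwK₀ : ∀ n, X.nrm n τ (w n) ≤ ENNReal.ofReal K₀ := by
    intro n
    rw [hwres]
    exact X.nrm_res_le _ hτ hτS (((X.scaled _).mono _ _ _ hτ hττ₄ hτ₄S).trans
      (ENNReal.ofReal_toReal hK₀.ne).ge)
  set ν := 2 * k + l + m + 2 with hν
  set δ := μ - ν with hδ
  obtain ⟨N, K, T', T, g, D, ω, hT', hT'T, hTτ, hTg, hstart, hD64, hDA, hcond⟩ :=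
    exists_stepCondition (d := d) (ν := ν) (δ := δ) (K₀ := K₀) (A := A)
      (c := Real.exp 1 * max C 0) (c' := 2 * Real.exp 1 * 2 ^ ν) (τ := τ) (q := p) hk hd
      (by linarith) (by linarith) (by positivity) hA1 hA2 hτ (by positivity) hp.2.2
  have hexp : ∀ (n : ℕ) (v : ArnoldSpace.component 𝔤 n), ∃ e : E n →ₗ[𝕜] E n,
      IsExp S (X.nrm n) (v : E n →ₗ[𝕜] E n) e ∧
        (X.scaled n).IsPointwiseExp (v : E n →ₗ[𝕜] E n) e := by
    rintro n ⟨_, u, hu, rfl⟩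
    exact ScaledSpace.exists_exp (h𝔤_two u hu n)
  choose exp hexp hpexp using hexp
  -- Before the index N the harmonic gain is too weak; nothing is corrected there and y is merely
  -- restricted.
  set v : ∀ n : ℕ, G n → ArnoldSpace.component 𝔤 n :=
    fun n y => if n < N then 0 else j n (α n) (-y) with hv
  have hmem : ∀ (n : ℕ) (y : G n), exp n (v n y) (w n + y) - w n ∈ G n := by
    intro n y
    obtain ⟨u, hu, huv⟩ := (v n y).2
    refine X.exp_sub_mem hM hFG.closed_right ?_ (hpexp n (v n y)) ?_
      (hρ n (α n) _ (v n y).2) y.2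
    · rw [← huv]; exact h𝔤_two u hu n
    · intro z hz
      rw [← huv]; exact h𝔤_G u hu n z hz
  obtain ⟨y, hy0, hy⟩ : ∃ y : ∀ n : ℕ, G n, y 0 = γ₀ ∧ ∀ n : ℕ, (y (n + 1) : E (n + 1 : ℕ)) =
      X.res (Nat.cast_le.2 (Nat.le_succ n)) (exp n (v n (y n)) (w n + y n) - w n) :=
    ⟨fun n => Nat.rec (motive := fun n : ℕ => G n) γ₀
      (fun n z => ⟨X.res (Nat.cast_le.2 (Nat.le_succ n)) (exp n (v n z) (w n + z) - w n),
        hFG.closed_right.res_mem _ _ (hmem n z)⟩) n, rfl, fun _ => rfl⟩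
  have hvlt : ∀ n < N, v n (y n) = 0 := fun n hn => if_pos hn
  have hvge : ∀ n, N ≤ n → v n (y n) = j n (α n) (-y n) := fun n hn => if_neg (not_lt.2 hn)
  have hearly : ∀ n ≤ N, (y n : E n) = X.resZero n γ₀ := by
    intro n
    induction n with
    | zero => intro _; rw [hy0, X.resZero_zero]
    | succ n ih =>
      intro hn
      have h0 := hpexp n (v n (y n))
      rw [hvlt n hn] at h0
      rw [hy, hvlt n hn, X.exp_zero_apply h0, add_sub_cancel_left, ih (by omega), X.res_resZero]
  have hmaj : ∀ i s, 0 < s → s ≤ T i →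
      X.nrm (N + i : ℕ) s (y (N + i)) ≤ ENNReal.ofReal (majorant ν (2 ^ i * δ) (D i) (T i) s) := by
    intro i
    induction i with
    | zero =>
      intro s hs hsT
      have hsτ := hsT.trans (hTτ 0)
      have h1 : X.nrm ((0 : ℕ) : ℕ∞) s γ₀ ≤ ENNReal.ofReal (max C 0 * s ^ μ) := by
        refine (hC s hs (hsτ.trans hττ₃)).trans (ENNReal.ofReal_le_ofReal ?_)
        gcongr
        exact le_max_left _ _
      rw [Nat.add_zero, hearly N le_rfl]
      refine (X.nrm_res_le _ hs (hsτ.trans_lt hτS) h1).trans (ENNReal.ofReal_le_ofReal ?_)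
      have := le_majorant_of_start (ν := ν) (hcond 0).T_pos hs hstart
      rw [show ν + δ = μ by rw [hδ]; ring] at this
      rw [pow_zero, one_mul]
      linarith
    | succ i ih =>
      intro s hs hsT
      have hj' : boundedNorm (X.subNrm G (N + i : ℕ)) (X.componentNrm 𝔤 (N + i : ℕ)) k τ
          (j (N + i : ℕ) (α (N + i : ℕ))) ≤ ENNReal.ofReal (max 1 (p (N + i))) :=
        (boundedNorm_mono hττ₁).trans ((hjp (N + i)).trans
          (ENNReal.ofReal_le_ofReal (le_max_right _ _)))
      have h0 := hpexp (N + i) (v (N + i) (y (N + i)))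
      rw [hvge _ (Nat.le_add_right N i)] at h0
      have h1 := X.step_bound (hcond i) hj' hτS (hTτ i) (hwK₀ _)
        (fun z s t hs hst ht hz => hquasi (N + i) z s t hs hst (ht.trans hττ₂) hz) ih h0 hs
        ((hTg i) ▸ hsT)
      have h2 := X.nrm_res_le (Nat.cast_le.2 (Nat.le_succ (N + i))) hs
        ((hsT.trans (hTτ (i + 1))).trans_lt hτS) h1
      -- The factor e of the restriction cancels the division by e in `step_bound`.
      rw [mul_div_cancel₀ _ (Real.exp_pos 1).ne', ← hTg i] at h2
      have h3 := hy (N + i)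
      rw [hvge _ (Nat.le_add_right N i)] at h3
      change X.nrm ((N + i + 1 : ℕ) : ℕ∞) s (y (N + i + 1)) ≤ _
      rw [h3, pow_succ', mul_assoc]
      exact h2
  obtain ⟨u, hu_top, hu⟩ : ∃ u : ∀ n, ArnoldSpace.component 𝔤 n, u ⊤ = 0 ∧
      ∀ n : ℕ, u n = v n (y n) :=
    ⟨fun n => ENat.recTopCoe (C := fun n => ArnoldSpace.component 𝔤 n) 0
      (fun n => v n (y n)) n, rfl, fun _ => rfl⟩
  -- The generators at level s are estimated from y at level 2s, which must not exceed any T_i.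
  set s₀ := T' / 2 with hs₀
  have hs₀0 : 0 < s₀ := half_pos hT'
  have hT'1 : T' ≤ 1 := (hT'T 0).trans (hcond 0).T_le
  have hT'S : T' < S := ((hT'T 0).trans (hTτ 0)).trans_lt hτS
  have hbound : ∀ s, 0 < s → s ≤ s₀ → ∀ n : ℕ, X.endNrm n s (u n) ≤
      ENNReal.ofReal (1 / 2 * (s ^ (k + l + m + 2) * Real.exp (-A ^ n) * (1 / 64) ^ n)) := by
    intro s hs hss₀ n
    rw [hu]
    rcases lt_or_ge n N with hn | hn
    · rw [hvlt n hn]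
      exact (X.endNrm_zero (by linarith)).trans_le zero_le
    · rw [hvge n hn]
      obtain ⟨i, rfl⟩ := Nat.exists_eq_add_of_le hn
      have h2s : 2 * s ≤ T i := by linarith [hT'T i]
      have h1 : X.nrm (N + i : ℕ) (2 * s) (-y (N + i) : G (N + i : ℕ)) ≤
          ENNReal.ofReal (majorant ν (2 ^ i * δ) (D i) (T i) (2 * s)) := by
        rw [Submodule.coe_neg]
        exact ((X.scaled _).nrm_neg (by positivity) (by linarith) _).trans_le
          (hmaj i _ (by positivity) h2s)
      refine (X.endNrm_apply_le (hjp (N + i)) (hp.2.1 _).le hs (by linarith)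
        ((h2s.trans (hTτ i)).trans hττ₁) hτ₁S h1).trans (ENNReal.ofReal_le_ofReal ?_)
      have h3 := majorant_le (ν := ν) (D := D i) (by positivity : 0 < 2 * s) h2s (hcond i).o_nonneg
      have hp0 := hp.2.1 (N + i)
      have h4 : p (N + i) * Real.exp (-D i) ≤
          (2 * Real.exp 1 * 2 ^ ν)⁻¹ * Real.exp (-A ^ (N + i)) * (1 / 64) ^ (N + i) := by
        have h5 := hDA i
        have hm : p (N + i) ≤ max 1 (p (N + i)) := le_max_right _ _
        rw [Real.exp_neg, Real.exp_neg, ← div_eq_mul_inv, div_le_iff₀ (Real.exp_pos _),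
          div_pow, one_pow]
        calc p (N + i) ≤ max 1 (p (N + i)) := hm
          _ = (2 * Real.exp 1 * 2 ^ ν)⁻¹ * (Real.exp (A ^ (N + i)))⁻¹ * (1 / 64 ^ (N + i)) *
              (2 * Real.exp 1 * 2 ^ ν * max 1 (p (N + i)) * 64 ^ (N + i) *
                Real.exp (A ^ (N + i))) := by field_simp
          _ ≤ _ := by gcongr
      rw [show 2 * s - s = s by ring, div_le_iff₀ (by positivity)]
      calc Real.exp 1 * p (N + i) * majorant ν (2 ^ i * δ) (D i) (T i) (2 * s)
          ≤ Real.exp 1 * p (N + i) * ((2 * s) ^ ν * Real.exp (-D i)) := by gcongr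
        _ = Real.exp 1 * 2 ^ ν * s ^ ν * (p (N + i) * Real.exp (-D i)) := by
            rw [Real.mul_rpow zero_le_two hs.le]; ring
        _ ≤ Real.exp 1 * 2 ^ ν * s ^ ν * ((2 * Real.exp 1 * 2 ^ ν)⁻¹ * Real.exp (-A ^ (N + i)) *
            (1 / 64) ^ (N + i)) := by gcongr
        _ = 1 / 2 * (s ^ ν * Real.exp (-A ^ (N + i)) * (1 / 64) ^ (N + i)) := by field_simp
        _ = _ := by
            -- Applying j between 2s and s costs s^(-k), which leaves the order ν - k = k + l + m +
            -- 2.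
            rw [show ν = (k + l + m + 2) + k by rw [hν]; ring, Real.rpow_add hs]; ring
  have hii : ∀ s, 0 < s → s ≤ s₀ → ∀ n : ℕ, X.endNrm n s (u n) <
      ENNReal.ofReal (s ^ (k + l + m + 2) * Real.exp (-A ^ n)) := by
    intro s hs hss₀ n
    have h1 : 0 < s ^ (k + l + m + 2) * Real.exp (-A ^ n) := by positivity
    refine (hbound s hs hss₀ n).trans_lt ((ENNReal.ofReal_lt_ofReal_iff h1).2 ?_)
    have h2 : (1 / 64 : ℝ) ^ n ≤ 1 := pow_le_one₀ (by norm_num) (by norm_num)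
    nlinarith
  have hprod : ∀ (n : ℕ) (s : ℝ), 0 < s → s ≤ s₀ →
      X.endNrm n s (v n (y n)) ≤ ENNReal.ofReal (s ^ 2 * (1 / 64) ^ n) := by
    intro n s hs hss₀
    rw [← hu]
    refine (hbound s hs hss₀ n).trans (ENNReal.ofReal_le_ofReal ?_)
    have h1 : s ^ (k + l + m + 2) ≤ s ^ 2 := by
      rw [← Real.rpow_two]
      exact Real.rpow_le_rpow_of_exponent_ge hs (by linarith) (by linarith)
    have h2 : Real.exp (-A ^ n) ≤ 1 := Real.exp_le_one_iff.2 (by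
      have : 0 < A ^ n := by positivity
      linarith)
    have h3 : s ^ (k + l + m + 2) * Real.exp (-A ^ n) * (1 / 64) ^ n ≤
        s ^ 2 * 1 * (1 / 64) ^ n := by gcongr
    have h4 : 0 ≤ s ^ (k + l + m + 2) * Real.exp (-A ^ n) * (1 / 64) ^ n := by positivity
    linarith
  obtain ⟨G', hG1, hG2, hG3⟩ := X.exists_infinite_product (fun n => hpexp n (v n (y n))) hs₀0 hprod
  refine ⟨fun n => u n, ⟨s₀, hs₀0, by linarith, ⟨fun _ => 1, isTamedSeq_one, fun n => ?_⟩, ?_⟩,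
    fun n => (u n).2, ⟨s₀, hs₀0, hii⟩, fun n => exp n (v n (y n)), G', fun n => ?_, hG1, hG2, ?_⟩
  · refine (hii s₀ hs₀0 le_rfl n).le.trans (ENNReal.ofReal_le_ofReal ?_)
    refine mul_le_one₀ (Real.rpow_le_one hs₀0.le (by linarith) (by linarith))
      (Real.exp_pos _).le (Real.exp_le_one_iff.2 ?_)
    have : 0 < A ^ n := by positivity
    linarith
  · have := X.endNrm_zero (n := ⊤) (s := s₀) (by linarith)
    change X.endNrm ⊤ s₀ (u ⊤ : E ⊤ →ₗ[𝕜] E ⊤) < ⊤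
    rw [hu_top]
    exact this.trans_lt ENNReal.zero_lt_top
  · change IsExp S (X.nrm n) (u n : E n →ₗ[𝕜] E n) _
    rw [hu]
    exact hexp n _
  · have hab : a + b = w (0 : ℕ) + y 0 := by
      rw [hwres, X.resZero_zero, hy0, hb']
      abel
    have hwsucc : ∀ n : ℕ, X.res (Nat.cast_le.2 (Nat.le_succ n)) (w n) = w (n + 1 : ℕ) := by
      intro n
      rw [hwres, hwres, X.res_resZero]
    have hlim : (X.scaled ⊤).Converges (fun n => X.res le_top
        (X.partialProd (fun n => exp n (v n (y n))) n (a + b))) (w ⊤) := by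
      refine ⟨T', hT', hT'S, ?_⟩
      rw [← tendsto_add_atTop_iff_nat N]
      have hz : Tendsto (fun i : ℕ => ENNReal.ofReal (Real.exp 1 * (1 / 64) ^ i)) atTop (𝓝 0) := by
        rw [← ENNReal.ofReal_zero]
        refine ENNReal.tendsto_ofReal ?_
        simpa using (tendsto_pow_atTop_nhds_zero_of_lt_one (r := (1 / 64 : ℝ)) (by norm_num)
          (by norm_num)).const_mul (Real.exp 1)
      refine tendsto_of_tendsto_of_tendsto_of_le_of_le tendsto_const_nhds
        (hz.comp (tendsto_add_atTop_nat 1)) (fun _ => zero_le) fun i => ?_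
      -- After n + 1 factors the distance to w_∞ is the restriction of y_(n+1), whose majorant at
      -- the fixed level T' tends to zero.
      have h1 : X.res le_top (X.partialProd (fun n => exp n (v n (y n))) (i + N) (a + b)) - w ⊤ =
          X.res le_top (y (N + (i + 1)) : E (N + (i + 1) : ℕ)) := by
        rw [hab, X.partialProd_apply_add (w := fun n => w n) (y := fun n => y n) hwsucc hy,
          add_comm i N]
        change _ = X.res le_top (y (N + i + 1) : E (N + i + 1 : ℕ))
        rw [hy, X.res_res, map_sub, hwres ⊤, hwres (N + i : ℕ), X.res_resZero]
      change X.nrm ⊤ T' _ ≤ _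
      rw [h1]
      refine (X.nrm_res_le le_top hT' hT'S (hmaj (i + 1) T' hT' (hT'T _))).trans
        (ENNReal.ofReal_le_ofReal ?_)
      gcongr
      refine (majorant_le hT' (hT'T _) (hcond (i + 1)).o_nonneg).trans ?_
      have h2 : T' ^ ν ≤ 1 := Real.rpow_le_one hT'.le hT'1 (by linarith)
      have h3 : Real.exp (-D (i + 1)) ≤ (1 / 64) ^ (i + 1) := by
        rw [div_pow, one_pow, Real.exp_neg, one_div]
        gcongr
        rw [← Real.log_le_log_iff (by positivity) (Real.exp_pos _), Real.log_exp, Real.log_pow]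
        exact hD64 (i + 1)
      calc T' ^ ν * Real.exp (-D (i + 1)) ≤ 1 * (1 / 64) ^ (i + 1) := by gcongr
        _ = _ := one_mul _
    rw [(hG3 (a + b)).unique hlim, hw, add_sub_cancel_left]
    exact (α ⊤).2
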